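/- Let $0<q<1$. For complex $\alpha$ put $(\alpha;q)_n=\prod_{k=0}^{n-1}(1-\alpha q^k)$ and $(\alpha;q)_\infty=\prod_{k=0}^{\infty}(1-\alpha q^k)$, and write $(a_1,\dots,a_m;q)_n=(a_1;q)_n\cdots(a_m;q)_n$ for $n\in\mathbb{N}\cup\{\infty\}$. Let $$h(x;a|q)=\prod_{k=0}^\infty(1-2q^kax+q^{2k}a^2),\qquad h(x;a_1,\dots,a_m|q)=h(x;a_1|q)\cdots h(x;a_m|q),$$ and let $${}_8W_7(\alpha;a_4,\dots,a_8;q,z)=\sum_{n=0}^\infty\frac{(\alpha,q\sqrt\alpha,-q\sqrt\alpha,a_4,\dots,a_8;q)_n\,z^n}{(q,\sqrt\alpha,-\sqrt\alpha,q\alpha/a_4,\dots,q\alpha/a_8;q)_n}.$$ **Theorem (Nassrallah–Rahman integral).** Let $a,b,c,d,u,v\in\mathbb{C}$ with $|a|,|b|,|c|,|u|,|v|<1$, and suppose that none of $abcd,\ ad,\ bd,\ cd$ equals $q^{-k}$ for an integer $k\ge 0$. Then the integral and the series below converge (the integrand is integrable and the series is absolutely convergent), and $$\int_0^\pi\frac{h(\cos2\theta;1|q)\,h(\cos\theta;d|q)}{h(\cos\theta;a,b,c,u,v|q)}\,d\theta=\frac{2\pi\,(abcu,abcv,ad,bd,cd;q)_\infty}{(q,abcd,ab,ac,au,av,bc,bu,bv,cu,cv;q)_\infty}\;{}_8W_7\!\left(\frac{abcd}{q};ab,ac,bc,\frac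 du,\frac dv;q,uv\right).$$ If one of $a,b,c,d,u,v$ is $0$, or if $abcd=q$, the series ${}_8W_7$ is understood with its quotients simplified, that is, as $$\sum_{n=0}^\infty\frac{w_n\,(ab,ac,bc;q)_n\,\prod_{k=0}^{n-1}(u-dq^k)(v-dq^k)}{(q,cd,bd,ad,abcu,abcv;q)_n},\qquad w_0=1,\quad w_n=(1-abcd\,q^{2n-1})\,(abcd;q)_{n-1}\ (n\ge1);$$ in all other cases this is the same series. -/

import Mathlib

noncomputable section

/-- The finite `q`-shifted factorial `(a; q)_n = ∏_{k<n} (1 - a q^k)`. -/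
def qPoch (q : ℝ) (a : ℂ) (n : ℕ) : ℂ :=
  ∏ k ∈ Finset.range n, (1 - a * (q : ℂ) ^ k)

/-- The infinite `q`-shifted factorial `(a; q)_∞ = ∏_{k≥0} (1 - a q^k)`. -/
def qPochInf (q : ℝ) (a : ℂ) : ℂ :=
  ∏' k : ℕ, (1 - a * (q : ℂ) ^ k)

/-- The multiple `q`-shifted factorial `(a₁, …, a_m; q)_n`. -/
def qPochs (q : ℝ) (l : List ℂ) (n : ℕ) : ℂ :=
  (l.map fun a => qPoch q a n).prod

/-- The multiple `q`-shifted factorial `(a₁, …, a_m; q)_∞`. -/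
def qPochsInf (q : ℝ) (l : List ℂ) : ℂ :=
  (l.map fun a => qPochInf q a).prod

/-- The `n`-th term of the basic hypergeometric series with numerator parameters `as`
and denominator parameters `bs`. -/
def basicHypTerm (q : ℝ) (as bs : List ℂ) (z : ℂ) (n : ℕ) : ℂ :=
  qPochs q as n * z ^ n / qPochs q ((q : ℂ) :: bs) n

/-- The numerator parameters `a₁, q√a₁, -q√a₁, a₄, …, a_{r+1}` of a very-well-poised series;
`l` is the list `a₄, …, a_{r+1}`. -/
def vwpNum (q : ℝ) (a₁ : ℂ) (l : List ℂ) : List ℂ :=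
  a₁ :: (q : ℂ) * a₁ ^ (1 / 2 : ℂ) :: -((q : ℂ) * a₁ ^ (1 / 2 : ℂ)) :: l

/-- The denominator parameters `√a₁, -√a₁, q a₁/a₄, …, q a₁/a_{r+1}` of a very-well-poised
series. -/
def vwpDen (q : ℝ) (a₁ : ℂ) (l : List ℂ) : List ℂ :=
  a₁ ^ (1 / 2 : ℂ) :: -(a₁ ^ (1 / 2 : ℂ)) :: l.map fun x => (q : ℂ) * a₁ / x

/-- The `n`-th term of the series `_{r+1}W_r (a₁; a₄, …, a_{r+1}; q, z)`. -/
def vwpTerm (q : ℝ) (a₁ : ℂ) (l : List ℂ) (z : ℂ) (n : ℕ) : ℂ :=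
  basicHypTerm q (vwpNum q a₁ l) (vwpDen q a₁ l) z n

/-- The very-well-poised series `_{r+1}W_r (a₁; a₄, …, a_{r+1}; q, z)`. It is `₈W₇` when `l`
has five entries. -/
def vwpSeries (q : ℝ) (a₁ : ℂ) (l : List ℂ) (z : ℂ) : ℂ :=
  ∑' n : ℕ, vwpTerm q a₁ l z n

/-- `h(x; a | q) = ∏_{k≥0} (1 - 2 q^k a x + q^{2k} a²)`. -/
def hFun (q : ℝ) (x : ℝ) (a : ℂ) : ℂ :=
  ∏' k : ℕ, (1 - 2 * (q : ℂ) ^ k * a * (x : ℂ) + (q : ℂ) ^ (2 * k) * a ^ 2)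

/-- `h(x; a₁, …, a_m | q) = h(x; a₁ | q) ⋯ h(x; a_m | q)`. -/
def hFuns (q : ℝ) (x : ℝ) (l : List ℂ) : ℂ :=
  (l.map fun a => hFun q x a).prod

/-- The integrand `h(cos 2θ; 1) h(cos θ; d) / h(cos θ; a, b, c, u, v)`. -/
def nrIntegrand (q : ℝ) (a b c d u v : ℂ) (θ : ℝ) : ℂ :=
  hFun q (Real.cos (2 * θ)) 1 * hFun q (Real.cos θ) d / hFuns q (Real.cos θ) [a, b, c, u, v]

/-- The product of infinite `q`-shifted factorials in the evaluation of the integral. -/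
def nrPrefactor (q : ℝ) (a b c d u v : ℂ) : ℂ :=
  2 * (Real.pi : ℂ) * qPochsInf q [a * b * c * u, a * b * c * v, a * d, b * d, c * d] /
    qPochsInf q [(q : ℂ), a * b * c * d, a * b, a * c, a * u, a * v, b * c, b * u, b * v,
      c * u, c * v]

/-- With `e = q α`, the factor `(α; q)_n (1 - α q^{2n}) / (1 - α)` with the common factor
`1 - α` cancelled, so that it is meaningful for `α = 1` too. -/
def vwpFactor (q : ℝ) (e : ℂ) : ℕ → ℂ
  | 0 => 1
  | n + 1 => (1 - e * (q : ℂ) ^ (2 * n + 1)) * qPoch q e n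

/-- The `n`-th term of `₈W₇ (abcd/q; ab, ac, bc, d/u, d/v; q, uv)` with all quotients of
parameters simplified: `q α / (ab) = cd`, ..., `q α / (d/u) = abcu`, and
`(d/u; q)_n u^n = ∏_{k<n} (u - d q^k)`. This also makes sense when some of
`a, b, c, d, u, v` vanish, and is the limit of the terms with nonzero parameters. -/
def nrTerm (q : ℝ) (a b c d u v : ℂ) (n : ℕ) : ℂ :=
  vwpFactor q (a * b * c * d) n * qPochs q [a * b, a * c, b * c] n *
    (∏ k ∈ Finset.range n, (u - d * (q : ℂ) ^ k) * (v - d * (q : ℂ) ^ k)) /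
    qPochs q [(q : ℂ), c * d, b * d, a * d, a * b * c * u, a * b * c * v] n

end

/-! Both sides are compared through their dependence on `u` and `v`. Multiplying the integrand by `1
- 2u cos θ + u²` replaces `u` by `uq`, and `v (1 - 2ux + u²) - u (1 - 2vx + v²) = (v - u)(1 - uv)`
does not involve `x`; hence the integral satisfies a three-term contiguous relation in `u`, `v`
(`nrInt_contiguous`). The series satisfies the same relation after normalization, because the
summand of the relation telescopes (`nrContig_succ`, `tsum_nrNormTerm_contiguous`).

At `v = d` the numerator factor `h(cos θ; d)` cancels, the series collapses to its first term, and
the claim is the Askey–Wilson integral. The relation then carries the identity from `v` to `vq`,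
hence to every `v = d q^m` (`nrNormInt_eq_of_eq_mul_pow`). These points accumulate at `0`, so the
identity theorem in `v`, and then in `d` and in `u`, removes all restrictions (`nrNormInt_eq`). For
this, both sides are first multiplied by infinite products that clear the poles.

The Askey–Wilson integral (`askeyWilson_integral`) comes from shifting a contour from `|z| = 1` to
`|z| = q`, which gives a recurrence under `a ↦ aq`. Iteration sends each parameter to `0`, and the
remaining constant is found from parameters `q, -q, √q, -√q`, where the integrand is elementary. -/

noncomputable section

open Filter Topology MeasureTheory

/-! ### Basic properties of `q`-shifted factorials -/

section QPochhammer

variable {q : ℝ}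

lemma summable_norm_neg_mul_pow (hq0 : 0 < q) (hq1 : q < 1) (a : ℂ) :
    Summable fun k : ℕ => ‖-(a * (q : ℂ) ^ k)‖ := by
  simp only [norm_neg, norm_mul, norm_pow, Complex.norm_real, Real.norm_of_nonneg hq0.le]
  exact (summable_geometric_of_lt_one hq0.le hq1).mul_left _

lemma multipliable_one_sub_mul_pow (hq0 : 0 < q) (hq1 : q < 1) (a : ℂ) :
    Multipliable fun k : ℕ => 1 - a * (q : ℂ) ^ k := by
  simpa only [sub_eq_add_neg] using
    multipliable_one_add_of_summable (summable_norm_neg_mul_pow hq0 hq1 a)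

lemma qPoch_succ (a : ℂ) (n : ℕ) : qPoch q a (n + 1) = qPoch q a n * (1 - a * (q : ℂ) ^ n) :=
  Finset.prod_range_succ _ _

lemma qPoch_zero_right (a : ℂ) : qPoch q a 0 = 1 := Finset.prod_range_zero _

lemma qPoch_succ' (a : ℂ) (n : ℕ) : qPoch q a (n + 1) = (1 - a) * qPoch q (a * q) n := by
  unfold qPoch
  rw [Finset.prod_range_succ', mul_comm]
  congr 1
  · simp
  · exact Finset.prod_congr rfl fun k _ => by ring

lemma qPochInf_eq_mul (hq0 : 0 < q) (hq1 : q < 1) (a : ℂ) :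
    qPochInf q a = (1 - a) * qPochInf q (a * q) := by
  unfold qPochInf
  have h : (fun n : ℕ => 1 - a * (q : ℂ) ^ (n + 1)) = fun k : ℕ => 1 - a * q * (q : ℂ) ^ k := by
    ext k; ring
  rw [tprod_eq_zero_mul' (h ▸ multipliable_one_sub_mul_pow hq0 hq1 (a * q)), h]
  simp

lemma qPochInf_eq_qPoch_mul (hq0 : 0 < q) (hq1 : q < 1) (a : ℂ) (n : ℕ) :
    qPochInf q a = qPoch q a n * qPochInf q (a * (q : ℂ) ^ n) := by
  induction n with
  | zero => simp [qPoch]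
  | succ n ih =>
    rw [ih, qPoch_succ, qPochInf_eq_mul hq0 hq1 (a * (q : ℂ) ^ n)]
    ring_nf

@[simp] lemma qPochInf_zero : qPochInf q 0 = 1 := by simp [qPochInf]

lemma qPochInf_ne_zero (hq0 : 0 < q) (hq1 : q < 1) {a : ℂ}
    (ha : ∀ k : ℕ, a * (q : ℂ) ^ k ≠ 1) : qPochInf q a ≠ 0 := by
  have := tprod_one_add_ne_zero_of_summable (f := fun k : ℕ => -(a * (q : ℂ) ^ k))
    (fun k h => ha k (by linear_combination -h)) (summable_norm_neg_mul_pow hq0 hq1 a)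
  simpa only [qPochInf, sub_eq_add_neg] using this

lemma mul_pow_ne_one (hq0 : 0 < q) (hq1 : q < 1) {a : ℂ} (ha : ‖a‖ < 1) (k : ℕ) :
    a * (q : ℂ) ^ k ≠ 1 := by
  intro h
  have h1 := congrArg norm h
  rw [norm_mul, norm_pow, Complex.norm_real, Real.norm_of_nonneg hq0.le, norm_one] at h1
  have := mul_le_of_le_one_right (norm_nonneg a) (pow_le_one₀ (n := k) hq0.le hq1.le)
  linarith

lemma qPochInf_ne_zero_of_norm_lt (hq0 : 0 < q) (hq1 : q < 1) {a : ℂ} (ha : ‖a‖ < 1) :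
    qPochInf q a ≠ 0 :=
  qPochInf_ne_zero hq0 hq1 (mul_pow_ne_one hq0 hq1 ha)

lemma qPoch_ne_zero {a : ℂ} (ha : ∀ k : ℕ, a * (q : ℂ) ^ k ≠ 1) (n : ℕ) : qPoch q a n ≠ 0 :=
  Finset.prod_ne_zero_iff.2 fun k _ => sub_ne_zero.2 (ha k).symm

lemma norm_qPoch_le (hq0 : 0 < q) (hq1 : q < 1) (a : ℂ) (n : ℕ) :
    ‖qPoch q a n‖ ≤ Real.exp (‖a‖ / (1 - q)) := by
  have h1 : ‖qPoch q a n‖ ≤ ∏ k ∈ Finset.range n, (1 + ‖a‖ * q ^ k) := by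
    unfold qPoch
    rw [norm_prod]
    refine Finset.prod_le_prod (fun _ _ => norm_nonneg _) fun k _ => ?_
    refine (norm_sub_le _ _).trans ?_
    simp [abs_of_pos hq0]
  refine h1.trans ((Real.prod_one_add_le_exp_sum _ fun k => by positivity).trans ?_)
  refine Real.exp_le_exp.2 ?_
  rw [← Finset.mul_sum, div_eq_mul_inv, ← tsum_geometric_of_lt_one hq0.le hq1]
  gcongr
  exact (summable_geometric_of_lt_one hq0.le hq1).sum_le_tsum _ fun k _ => by positivity

lemma tendsto_qPoch (hq0 : 0 < q) (hq1 : q < 1) (a : ℂ) :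
    Tendsto (qPoch q a) atTop (𝓝 (qPochInf q a)) :=
  (multipliable_one_sub_mul_pow hq0 hq1 a).tendsto_prod_tprod_nat

lemma norm_qPochInf_le (hq0 : 0 < q) (hq1 : q < 1) (a : ℂ) :
    ‖qPochInf q a‖ ≤ Real.exp (‖a‖ / (1 - q)) :=
  le_of_tendsto (tendsto_qPoch hq0 hq1 a).norm (Eventually.of_forall (norm_qPoch_le hq0 hq1 a))

/-- On a ball of radius `R` the factors differ from `1` by at most `R q^k`, so the product converges
locally uniformly. All holomorphy below rests on this. -/
lemma differentiable_qPochInf (hq0 : 0 < q) (hq1 : q < 1) : Differentiable ℂ (qPochInf q) := by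
  have key : ∀ R : ℝ, DifferentiableOn ℂ (qPochInf q) (Metric.ball 0 R) := by
    intro R
    have hs : Summable fun k : ℕ => R * q ^ k :=
      (summable_geometric_of_lt_one hq0.le hq1).mul_left R
    have h := hs.hasProdLocallyUniformlyOn_nat_one_add
      (f := fun k a => -(a * (q : ℂ) ^ k)) (K := Metric.ball (0 : ℂ) R) Metric.isOpen_ball
      (Eventually.of_forall fun k x hx => by
        rw [norm_neg, norm_mul, norm_pow, Complex.norm_real, Real.norm_of_nonneg hq0.le]
        have : ‖x‖ < R := by simpa using hx
        gcongr)
      (fun k => by fun_prop)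
    simp only [← sub_eq_add_neg] at h
    exact h.differentiableOn
      (.of_forall fun _ => by simpa [Finset.prod_fn] using
        DifferentiableOn.finsetProd (fun _ _ => by fun_prop)) Metric.isOpen_ball
  intro a
  exact (key (‖a‖ + 1)).differentiableAt (Metric.isOpen_ball.mem_nhds (by simp))

/-- Each factor splits as `(1 - a q^k z)(1 - a q^k / z)` with `z = e^{iθ}`. -/
lemma hFun_cos (hq0 : 0 < q) (hq1 : q < 1) (a : ℂ) (θ : ℝ) :
    hFun q (Real.cos θ) a = qPochInf q (a * Complex.exp (θ * Complex.I)) *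
      qPochInf q (a * (Complex.exp (θ * Complex.I))⁻¹) := by
  unfold hFun qPochInf
  rw [← (multipliable_one_sub_mul_pow hq0 hq1 _).tprod_mul
    (multipliable_one_sub_mul_pow hq0 hq1 _)]
  congr 1
  ext k
  rw [Complex.ofReal_cos, Complex.cos, ← Complex.exp_neg]
  have h : Complex.exp (θ * Complex.I) * Complex.exp (-(θ * Complex.I)) = 1 := by
    rw [← Complex.exp_add]; simp
  have h' : Complex.exp (-θ * Complex.I) = Complex.exp (-(θ * Complex.I)) := by ring_nf
  rw [h']
  linear_combination (-(a ^ 2 * (q : ℂ) ^ (2 * k))) * h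

/-- `(a; q)_∞ = (a; q²)_∞ (aq; q²)_∞`. -/
lemma qPochInf_sq_mul (hq0 : 0 < q) (hq1 : q < 1) (a : ℂ) :
    qPochInf (q ^ 2) a * qPochInf (q ^ 2) (a * q) = qPochInf q a := by
  have h1 : q ^ 2 < 1 := by nlinarith
  have e1 : (fun k : ℕ => 1 - a * ((q ^ 2 : ℝ) : ℂ) ^ k) =
      fun k => 1 - a * (q : ℂ) ^ (2 * k) := by
    ext k; push_cast; rw [pow_mul]
  have e2 : (fun k : ℕ => 1 - a * q * ((q ^ 2 : ℝ) : ℂ) ^ k) =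
      fun k => 1 - a * (q : ℂ) ^ (2 * k + 1) := by
    ext k; push_cast; rw [pow_succ (q : ℂ) (2 * k), pow_mul]; ring
  have m1 := e1 ▸ multipliable_one_sub_mul_pow (pow_pos hq0 2) h1 a
  have m2 := e2 ▸ multipliable_one_sub_mul_pow (pow_pos hq0 2) h1 (a * q)
  have h := tprod_even_mul_odd (f := fun k : ℕ => 1 - a * (q : ℂ) ^ k) m1 m2
  rw [qPochInf, qPochInf, qPochInf, e1, e2, h]

/-- `(a; q)_∞ (-a; q)_∞ = (a²; q²)_∞`. -/
lemma qPochInf_mul_neg (hq0 : 0 < q) (hq1 : q < 1) (a : ℂ) :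
    qPochInf q a * qPochInf q (-a) = qPochInf (q ^ 2) (a ^ 2) := by
  unfold qPochInf
  rw [← (multipliable_one_sub_mul_pow hq0 hq1 _).tprod_mul
    (multipliable_one_sub_mul_pow hq0 hq1 _)]
  congr 1
  ext k
  push_cast
  ring

end QPochhammer

/-! ### Integrals depending holomorphically on a parameter, and contour shifts -/

section ParametricIntegrals

/-- The integral over a bounded interval of a continuous function depending holomorphically on a
parameter is holomorphic in the parameter. -/
lemma differentiableOn_intervalIntegral_param {U : Set ℂ} (hU : IsOpen U) {F : ℂ → ℝ → ℂ}
    (hc : ContinuousOn (Function.uncurry F) (U ×ˢ Set.univ))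
    (hd : ∀ θ, DifferentiableOn ℂ (fun w => F w θ) U) (A B : ℝ) :
    DifferentiableOn ℂ (fun w => ∫ θ in A..B, F w θ) U := by
  intro w₀ hw₀
  obtain ⟨R, hR, hRU⟩ := Metric.nhds_basis_closedBall.mem_iff.1 (hU.mem_nhds hw₀)
  have hcont : ∀ w ∈ U, Continuous (F w) := fun w hw => by
    have : ContinuousOn (fun θ : ℝ => Function.uncurry F (w, θ)) Set.univ :=
      hc.comp (by fun_prop) fun θ _ => ⟨hw, trivial⟩
    exact continuousOn_univ.1 this
  obtain ⟨M, hM⟩ := ((isCompact_closedBall w₀ R).prod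
    (isCompact_uIcc (a := A) (b := B))).exists_bound_of_continuousOn
      (hc.mono (Set.prod_mono hRU (Set.subset_univ _)))
  -- Half the radius leaves room for a Cauchy estimate on a circle of radius `r` about any point of
  -- the smaller ball, which yields the bound `M / r` on the derivative.
  set r := R / 2 with hr
  have hr0 : 0 < r := by positivity
  have hball : ∀ x ∈ Metric.ball w₀ r, Metric.closedBall x r ⊆ Metric.closedBall w₀ R := by
    intro x hx
    refine Metric.closedBall_subset_closedBall' ?_
    have := Metric.mem_ball.1 hx
    linarith
  have hDat : ∀ θ, ∀ x ∈ U, HasDerivAt (fun w => F w θ) (deriv (fun w => F w θ) x) x :=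
    fun θ x hx => ((hd θ).differentiableAt (hU.mem_nhds hx)).hasDerivAt
  have hsub : ∀ x ∈ Metric.ball w₀ r, x ∈ U := fun x hx =>
    hRU (hball x hx (Metric.mem_closedBall_self hr0.le))
  have key := intervalIntegral.hasDerivAt_integral_of_dominated_loc_of_deriv_le
    (μ := volume) (a := A) (b := B) (F := F) (F' := fun w θ => deriv (fun w => F w θ) w)
    (x₀ := w₀) (s := Metric.ball w₀ r) (bound := fun _ => M / r)
    (Metric.ball_mem_nhds _ hr0)
    (eventually_of_mem (hU.mem_nhds hw₀) fun w hw => (hcont w hw).aestronglyMeasurable)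
    ((hcont w₀ hw₀).intervalIntegrable _ _)
    (by
      have hseq : Tendsto (fun n : ℕ => w₀ + ((r / (n + 1) : ℝ) : ℂ)) atTop (𝓝[≠] w₀) := by
        refine tendsto_nhdsWithin_iff.2 ⟨?_, Eventually.of_forall fun n => ?_⟩
        · have h1 : Tendsto (fun n : ℕ => r / ((n : ℝ) + 1)) atTop (𝓝 0) := by
            simpa [div_eq_mul_inv] using
              (tendsto_one_div_add_atTop_nhds_zero_nat (𝕜 := ℝ)).const_mul r
          simpa using (Complex.continuous_ofReal.tendsto 0 |>.comp h1).const_add w₀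
        · have : r / ((n : ℝ) + 1) ≠ 0 := by positivity
          simpa only [Set.mem_compl_iff, Set.mem_singleton_iff, add_eq_left,
            Complex.ofReal_eq_zero] using this
      -- The parameter derivative is measurable in `θ` as a limit of difference quotients. The
      -- denominator `n + 2` keeps the sample points strictly inside the ball of radius `r`.
      refine aestronglyMeasurable_of_tendsto_ae (u := atTop)
        (f := fun (n : ℕ) θ => slope (fun w => F w θ) w₀ (w₀ + ((r / (n + 2) : ℝ) : ℂ))) ?_ ?_
      · intro n
        have hmem : w₀ + ((r / (n + 2) : ℝ) : ℂ) ∈ U := by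
          refine hsub _ ?_
          rw [Metric.mem_ball, dist_eq_norm, add_sub_cancel_left, Complex.norm_real,
            Real.norm_of_nonneg (by positivity)]
          exact div_lt_self hr0 (by linarith [(Nat.cast_nonneg n : (0 : ℝ) ≤ n)])
        simp only [slope_def_field]
        exact (((hcont _ hmem).sub (hcont _ hw₀)).div_const _).aestronglyMeasurable
      · refine Eventually.of_forall fun θ => ?_
        have h := (hasDerivAt_iff_tendsto_slope.1 (hDat θ w₀ hw₀)).comp
          (hseq.comp (tendsto_add_atTop_nat 1))
        refine h.congr fun n => ?_
        simp only [Function.comp_apply]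
        congr 4
        push_cast
        ring)
    (Eventually.of_forall fun θ hθ x hx => by
      refine Complex.norm_deriv_le_of_forall_mem_sphere_norm_le hr0 ?_ ?_
      · refine DifferentiableOn.diffContOnCl ?_
        rw [closure_ball _ hr0.ne']
        exact (hd θ).mono ((hball x hx).trans hRU)
      · intro z hz
        exact hM (z, θ) ⟨hball x hx (Metric.sphere_subset_closedBall hz),
          Set.uIoc_subset_uIcc hθ⟩)
    (by simp)
    (Eventually.of_forall fun θ _ x hx => hDat θ x (hsub x hx))
  exact key.2.differentiableAt.differentiableWithinAt

/-- Cauchy's theorem on the annulus for `F(z) / z`, since `dz / z = i dθ` on every circle about `0`.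
-/
lemma integral_circle_eq_of_annulus {r : ℝ} (h0 : 0 < r) (h1 : r ≤ 1) {F : ℂ → ℂ}
    (hF : ∀ z : ℂ, r ≤ ‖z‖ → ‖z‖ ≤ 1 → DifferentiableAt ℂ F z) :
    ∫ θ in (0 : ℝ)..2 * Real.pi, F (Complex.exp (θ * Complex.I)) =
      ∫ θ in (0 : ℝ)..2 * Real.pi, F (r * Complex.exp (θ * Complex.I)) := by
  have h := Complex.circleIntegral_sub_center_inv_smul_eq_of_differentiable_on_annulus_off_countable
    (c := 0) h0 h1 (f := F) Set.countable_empty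
    (fun z hz => (hF z (by simpa using hz.2) (by simpa using hz.1)).continuousAt.continuousWithinAt)
    (fun z hz => hF z (by simpa using (le_of_not_ge fun h => hz.1.2 (by simpa using h)))
      (by simpa using (Metric.mem_ball.1 hz.1.1).le))
  have e : ∀ R : ℝ, R ≠ 0 → (∮ z in C(0, R), (z - 0)⁻¹ • F z) =
      Complex.I * ∫ θ in (0 : ℝ)..2 * Real.pi, F (R * Complex.exp (θ * Complex.I)) := by
    intro R hR
    rw [circleIntegral, ← intervalIntegral.integral_const_mul]
    refine intervalIntegral.integral_congr fun θ _ => ?_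
    have : (R : ℂ) ≠ 0 := by exact_mod_cast hR
    simp only [deriv_circleMap, circleMap_zero, smul_eq_mul, sub_zero]
    field_simp
  rw [e 1 one_ne_zero, e r h0.ne'] at h
  simpa using mul_left_cancel₀ Complex.I_ne_zero h

lemma exp_two_pi_sub_mul_I (θ : ℝ) :
    Complex.exp (((2 * Real.pi - θ : ℝ) : ℂ) * Complex.I) = (Complex.exp (θ * Complex.I))⁻¹ := by
  rw [← Complex.exp_neg]
  push_cast
  rw [sub_mul, Complex.exp_sub, Complex.exp_two_pi_mul_I, Complex.exp_neg, one_div]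

/-- A function holomorphic in an annulus `r ≤ |z| ≤ 1` with `F (r z) = -F (1 / z)` on the unit
circle has a symmetrization of vanishing integral. -/
lemma integral_add_inv_eq_zero {r : ℝ} (h0 : 0 < r) (h1 : r ≤ 1) {F : ℂ → ℂ}
    (hF : ∀ z : ℂ, r ≤ ‖z‖ → ‖z‖ ≤ 1 → DifferentiableAt ℂ F z)
    (hodd : ∀ z : ℂ, ‖z‖ = 1 → F (r * z) = -F z⁻¹) :
    ∫ θ in (0 : ℝ)..Real.pi,
      (F (Complex.exp (θ * Complex.I)) + F (Complex.exp (θ * Complex.I))⁻¹) = 0 := by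
  have hcont : Continuous fun θ : ℝ => F (Complex.exp (θ * Complex.I)) := by
    refine continuous_iff_continuousAt.2 fun θ => ?_
    exact ContinuousAt.comp (g := F) (f := fun θ : ℝ => Complex.exp (θ * Complex.I))
      (hF _ (by simpa [Complex.norm_exp_ofReal_mul_I] using h1)
        (by simp [Complex.norm_exp_ofReal_mul_I])).continuousAt (by fun_prop)
  have hrefl : ∀ A B : ℝ, ∫ θ in A..B, F (Complex.exp (θ * Complex.I))⁻¹ =
      ∫ θ in (2 * Real.pi - B)..(2 * Real.pi - A), F (Complex.exp (θ * Complex.I)) := by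
    intro A B
    rw [← intervalIntegral.integral_comp_sub_left
      (fun θ : ℝ => F (Complex.exp (θ * Complex.I)))]
    simp only [exp_two_pi_sub_mul_I]
  have hinv : Continuous fun θ : ℝ => F (Complex.exp (θ * Complex.I))⁻¹ := by
    have := hcont.comp (f := fun θ : ℝ => 2 * Real.pi - θ) (by fun_prop)
    simpa only [Function.comp_def, exp_two_pi_sub_mul_I] using this
  -- Moving to radius `r` turns the full-circle integral into minus the integral of `F(1/z)`, which
  -- by reflection is minus the original one.
  have hfull : ∫ θ in (0 : ℝ)..2 * Real.pi, F (Complex.exp (θ * Complex.I)) = 0 := by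
    have e1 := integral_circle_eq_of_annulus h0 h1 hF
    have e2 := hrefl 0 (2 * Real.pi)
    simp only [sub_self, sub_zero] at e2
    have e3 : ∫ θ in (0 : ℝ)..2 * Real.pi, F (r * Complex.exp (θ * Complex.I)) =
        -∫ θ in (0 : ℝ)..2 * Real.pi, F (Complex.exp (θ * Complex.I))⁻¹ := by
      rw [← intervalIntegral.integral_neg]
      exact intervalIntegral.integral_congr fun θ _ =>
        hodd _ (Complex.norm_exp_ofReal_mul_I θ)
    rw [e3, e2] at e1
    linear_combination e1 / 2
  rw [intervalIntegral.integral_add (hcont.intervalIntegrable _ _) (hinv.intervalIntegrable _ _),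
    hrefl, show 2 * Real.pi - Real.pi = Real.pi by ring, sub_zero,
    intervalIntegral.integral_add_adjacent_intervals (hcont.intervalIntegrable _ _)
      (hcont.intervalIntegrable _ _), hfull]

end ParametricIntegrals

/-! ### The Nassrallah–Rahman integral as a function of its parameters -/

section Integrand

variable {q : ℝ}

/-- The Nassrallah–Rahman integral. -/
def nrInt (q : ℝ) (a b c d u v : ℂ) : ℂ :=
  ∫ θ in (0 : ℝ)..Real.pi, nrIntegrand q a b c d u v θ

lemma continuous_hFun_cos (hq0 : 0 < q) (hq1 : q < 1) :
    Continuous fun p : ℂ × ℝ => hFun q (Real.cos p.2) p.1 := by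
  have hc := (differentiable_qPochInf hq0 hq1).continuous
  simp only [hFun_cos hq0 hq1]
  refine (hc.comp (by fun_prop)).mul (hc.comp ?_)
  simp only [← Complex.exp_neg]
  fun_prop

lemma differentiable_hFun_cos (hq0 : 0 < q) (hq1 : q < 1) (θ : ℝ) :
    Differentiable ℂ fun a : ℂ => hFun q (Real.cos θ) a := by
  have hc := differentiable_qPochInf hq0 hq1
  simp only [hFun_cos hq0 hq1]
  exact (hc.comp (by fun_prop)).mul (hc.comp (by fun_prop))

lemma hFun_cos_ne_zero (hq0 : 0 < q) (hq1 : q < 1) {a : ℂ} (ha : ‖a‖ < 1) (θ : ℝ) :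
    hFun q (Real.cos θ) a ≠ 0 := by
  rw [hFun_cos hq0 hq1]
  refine mul_ne_zero (qPochInf_ne_zero_of_norm_lt hq0 hq1 ?_)
    (qPochInf_ne_zero_of_norm_lt hq0 hq1 ?_) <;>
  simpa [Complex.norm_exp_ofReal_mul_I] using ha

lemma hFun_zero (x : ℝ) : hFun q x 0 = 1 := by simp [hFun]

lemma hFun_cos_eq_mul (hq0 : 0 < q) (hq1 : q < 1) (a : ℂ) (θ : ℝ) :
    hFun q (Real.cos θ) a =
      (1 - 2 * a * (Real.cos θ : ℂ) + a ^ 2) * hFun q (Real.cos θ) (a * q) := by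
  rw [hFun_cos hq0 hq1, hFun_cos hq0 hq1, qPochInf_eq_mul hq0 hq1 (a * _),
    qPochInf_eq_mul hq0 hq1 (a * (Complex.exp (θ * Complex.I))⁻¹), mul_right_comm a (Complex.exp _),
    mul_right_comm a (Complex.exp _)⁻¹, Complex.ofReal_cos, Complex.cos, ← Complex.exp_neg]
  have h : Complex.exp (θ * Complex.I) * Complex.exp (-(θ * Complex.I)) = 1 := by
    rw [← Complex.exp_add]; simp
  rw [neg_mul]
  linear_combination (a ^ 2 * (qPochInf q (a * q * Complex.exp (θ * Complex.I)) *
    qPochInf q (a * q * Complex.exp (-(θ * Complex.I))))) * h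

lemma nrIntegrand_eq (a b c d u v : ℂ) (θ : ℝ) : nrIntegrand q a b c d u v θ =
    hFun q (Real.cos (2 * θ)) 1 * hFun q (Real.cos θ) d /
      (hFun q (Real.cos θ) a * hFun q (Real.cos θ) b * hFun q (Real.cos θ) c *
        hFun q (Real.cos θ) u * hFun q (Real.cos θ) v) := by
  simp [nrIntegrand, hFuns, mul_assoc]

lemma continuousOn_nrIntegrand (hq0 : 0 < q) (hq1 : q < 1) {U : Set ℂ} {b c u v : ℂ}
    (hb : ‖b‖ < 1) (hc : ‖c‖ < 1) (hu : ‖u‖ < 1) (hv : ‖v‖ < 1) {α δ : ℂ → ℂ}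
    (hα : Continuous α) (hδ : Continuous δ) (hU : ∀ w ∈ U, ‖α w‖ < 1) :
    ContinuousOn (Function.uncurry fun w θ => nrIntegrand q (α w) b c (δ w) u v θ)
      (U ×ˢ Set.univ) := by
  have h : ∀ {f : ℂ × ℝ → ℂ} {g : ℂ × ℝ → ℝ}, Continuous f → Continuous g →
      Continuous fun p : ℂ × ℝ => hFun q (Real.cos (g p)) (f p) := fun hf hg =>
    (continuous_hFun_cos hq0 hq1).comp (hf.prodMk hg)
  simp only [Function.uncurry_def, nrIntegrand_eq]
  refine ContinuousOn.div (Continuous.continuousOn ?_) (Continuous.continuousOn ?_) ?_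
  · exact (h (f := fun _ => 1) continuous_const (by fun_prop)).mul
      (h (by fun_prop) (by fun_prop))
  · exact ((((h (by fun_prop) (by fun_prop)).mul (h (by fun_prop) (by fun_prop))).mul
      (h (by fun_prop) (by fun_prop))).mul (h (by fun_prop) (by fun_prop))).mul
      (h (by fun_prop) (by fun_prop))
  · rintro ⟨w, θ⟩ ⟨hw, -⟩
    have this : ∀ {x : ℂ}, ‖x‖ < 1 → hFun q (Real.cos θ) x ≠ 0 := fun hx =>
      hFun_cos_ne_zero hq0 hq1 hx θ
    simp [this (hU w hw), this hb, this hc, this hu, this hv]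

lemma continuous_nrIntegrand (hq0 : 0 < q) (hq1 : q < 1) {a b c u v : ℂ} (d : ℂ)
    (ha : ‖a‖ < 1) (hb : ‖b‖ < 1) (hc : ‖c‖ < 1) (hu : ‖u‖ < 1) (hv : ‖v‖ < 1) :
    Continuous (nrIntegrand q a b c d u v) := by
  have h := (continuousOn_nrIntegrand hq0 hq1 (U := Set.univ) hb hc hu hv
    (continuous_const (y := a)) (continuous_const (y := d)) fun _ _ => ha).comp
    (g := Function.uncurry fun _ θ => nrIntegrand q a b c d u v θ)
    (f := fun θ : ℝ => ((0 : ℂ), θ)) (s := Set.univ) (by fun_prop) (fun θ _ => ⟨trivial, trivial⟩)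
  exact continuousOn_univ.1 h

lemma differentiableOn_nrInt_left (hq0 : 0 < q) (hq1 : q < 1) {b c u v : ℂ} (d : ℂ)
    (hb : ‖b‖ < 1) (hc : ‖c‖ < 1) (hu : ‖u‖ < 1) (hv : ‖v‖ < 1) :
    DifferentiableOn ℂ (fun a => nrInt q a b c d u v) (Metric.ball 0 1) := by
  refine differentiableOn_intervalIntegral_param Metric.isOpen_ball
    (continuousOn_nrIntegrand hq0 hq1 hb hc hu hv continuous_id continuous_const
      fun w hw => by simpa using hw) (fun θ => ?_) 0 Real.pi
  simp only [nrIntegrand_eq]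
  have h := differentiable_hFun_cos hq0 hq1 θ
  refine DifferentiableOn.div (by fun_prop) (by fun_prop) fun w hw => ?_
  have this : ∀ {x : ℂ}, ‖x‖ < 1 → hFun q (Real.cos θ) x ≠ 0 := fun hx =>
      hFun_cos_ne_zero hq0 hq1 hx θ
  simp [this (show ‖w‖ < 1 by simpa using hw), this hb, this hc, this hu, this hv]

lemma differentiable_nrInt_numerator (hq0 : 0 < q) (hq1 : q < 1) {a b c u v : ℂ}
    (ha : ‖a‖ < 1) (hb : ‖b‖ < 1) (hc : ‖c‖ < 1) (hu : ‖u‖ < 1) (hv : ‖v‖ < 1) :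
    Differentiable ℂ (fun d => nrInt q a b c d u v) := by
  refine differentiableOn_univ.1 (differentiableOn_intervalIntegral_param isOpen_univ
    (continuousOn_nrIntegrand hq0 hq1 hb hc hu hv continuous_const continuous_id
      fun w hw => ha) (fun θ => ?_) 0 Real.pi)
  simp only [nrIntegrand_eq]
  have h := differentiable_hFun_cos hq0 hq1 θ
  fun_prop

/-! ### Symmetries and the contiguous relation of the integral -/

lemma nrInt_swap_left (a b c d u v : ℂ) : nrInt q a b c d u v = nrInt q b a c d u v := by
  refine intervalIntegral.integral_congr fun θ _ => ?_
  simp only [nrIntegrand_eq]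
  ring_nf

lemma nrInt_swap_middle (a b c d u v : ℂ) : nrInt q a b c d u v = nrInt q a c b d u v := by
  refine intervalIntegral.integral_congr fun θ _ => ?_
  simp only [nrIntegrand_eq]
  ring_nf

lemma nrInt_swap_cu (a b c d u v : ℂ) : nrInt q a b c d u v = nrInt q a b u d c v := by
  refine intervalIntegral.integral_congr fun θ _ => ?_
  simp only [nrIntegrand_eq]
  ring_nf

lemma nrInt_swap_right (a b c d u v : ℂ) : nrInt q a b c d u v = nrInt q a b c d v u := by
  refine intervalIntegral.integral_congr fun θ _ => ?_
  simp only [nrIntegrand_eq]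
  ring_nf

/-- The starting point of the induction. With its fourth and sixth parameters `0`, `nrInt` is the
Askey–Wilson integral. -/
lemma nrInt_eq_of_eq (hq0 : 0 < q) (hq1 : q < 1) {d : ℂ} (a b c u : ℂ) (hd : ‖d‖ < 1) :
    nrInt q a b c d u d = nrInt q a b c 0 u 0 := by
  refine intervalIntegral.integral_congr fun θ _ => ?_
  simp only [nrIntegrand_eq, hFun_zero]
  have := hFun_cos_ne_zero hq0 hq1 hd θ
  rw [mul_div_mul_right _ _ this, mul_one, mul_one]

lemma differentiableOn_nrInt_right (hq0 : 0 < q) (hq1 : q < 1) {a b c u : ℂ} (d : ℂ)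
    (ha : ‖a‖ < 1) (hb : ‖b‖ < 1) (hc : ‖c‖ < 1) (hu : ‖u‖ < 1) :
    DifferentiableOn ℂ (fun v => nrInt q a b c d u v) (Metric.ball 0 1) := by
  refine (differentiableOn_nrInt_left hq0 hq1 d hb hc hu ha).congr fun v _ => ?_
  refine intervalIntegral.integral_congr fun θ _ => ?_
  simp only [nrIntegrand_eq]
  ring_nf

lemma norm_mul_ofReal_lt (hq0 : 0 < q) (hq1 : q < 1) {u : ℂ} (hu : ‖u‖ < 1) : ‖u * q‖ < 1 := by
  rw [norm_mul, Complex.norm_real, Real.norm_of_nonneg hq0.le]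
  exact mul_lt_one_of_nonneg_of_lt_one_left (norm_nonneg _) hu hq1.le

lemma nrIntegrand_mul_q (hq0 : 0 < q) (hq1 : q < 1) {a b c u v : ℂ} (d : ℂ)
    (hu : ‖u‖ < 1) (θ : ℝ) :
    nrIntegrand q a b c d (u * q) v θ =
      (1 - 2 * u * (Real.cos θ : ℂ) + u ^ 2) * nrIntegrand q a b c d u v θ := by
  have h := hFun_cos_eq_mul hq0 hq1 u θ
  have h0 := hFun_cos_ne_zero hq0 hq1 hu θ
  simp only [nrIntegrand_eq]
  rw [h] at h0 ⊢
  obtain ⟨h1, h2⟩ := mul_ne_zero_iff.1 h0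
  rw [← mul_div_assoc, ← mul_div_mul_left _ _ h1]
  congr 1
  ring

/-- The contiguous relation of the Nassrallah–Rahman integral in two denominator parameters. -/
lemma nrInt_contiguous (hq0 : 0 < q) (hq1 : q < 1) {a b c u v : ℂ} (d : ℂ)
    (ha : ‖a‖ < 1) (hb : ‖b‖ < 1) (hc : ‖c‖ < 1) (hu : ‖u‖ < 1) (hv : ‖v‖ < 1) :
    v * nrInt q a b c d (u * q) v - u * nrInt q a b c d u (v * q) =
      (v - u) * (1 - u * v) * nrInt q a b c d u v := by
  rw [nrInt_swap_right a b c d u]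
  unfold nrInt
  rw [← intervalIntegral.integral_const_mul, ← intervalIntegral.integral_const_mul,
    ← intervalIntegral.integral_const_mul, ← intervalIntegral.integral_sub]
  · refine intervalIntegral.integral_congr fun θ _ => ?_
    rw [nrIntegrand_mul_q hq0 hq1 d hu, nrIntegrand_mul_q hq0 hq1 d hv]
    have : nrIntegrand q a b c d v u θ = nrIntegrand q a b c d u v θ := by
      simp only [nrIntegrand_eq]; ring_nf
    rw [this]
    ring
  · exact ((continuous_nrIntegrand hq0 hq1 d ha hb hc (norm_mul_ofReal_lt hq0 hq1 hu)
      hv).const_mul _).intervalIntegrable _ _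
  · exact ((continuous_nrIntegrand hq0 hq1 d ha hb hc (norm_mul_ofReal_lt hq0 hq1 hv)
      hu).const_mul _).intervalIntegrable _ _

end Integrand

/-! ### The Askey–Wilson integral -/

section AskeyWilson

variable {q : ℝ}

/-- The function whose contour shift from `|z| = 1` to `|z| = q` gives the recurrence for the
Askey–Wilson integral. -/
def awShift (q : ℝ) (a b c d z : ℂ) : ℂ :=
  z ^ 3 * qPochInf q (q * z ^ 2) * qPochInf q (z⁻¹ ^ 2) /
    (qPochInf q (a * z) * qPochInf q (b * z) * qPochInf q (c * z) * qPochInf q (d * z) *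
      (qPochInf q (a * q * z⁻¹) * qPochInf q (b * q * z⁻¹) * qPochInf q (c * q * z⁻¹) *
        qPochInf q (d * q * z⁻¹)))

lemma differentiableAt_awShift (hq0 : 0 < q) (hq1 : q < 1) {a b c d z : ℂ} (ha : ‖a‖ < 1)
    (hb : ‖b‖ < 1) (hc : ‖c‖ < 1) (hd : ‖d‖ < 1) (h1 : q ≤ ‖z‖) (h2 : ‖z‖ ≤ 1) :
    DifferentiableAt ℂ (awShift q a b c d) z := by
  have hz : z ≠ 0 := norm_pos_iff.1 (hq0.trans_le h1)
  have hp := differentiable_qPochInf hq0 hq1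
  have hout : ∀ x : ℂ, ‖x‖ < 1 → qPochInf q (x * z) ≠ 0 := fun x hx => by
    refine qPochInf_ne_zero_of_norm_lt hq0 hq1 ?_
    rw [norm_mul]
    exact (mul_le_of_le_one_right (norm_nonneg _) h2).trans_lt hx
  have hin : ∀ x : ℂ, ‖x‖ < 1 → qPochInf q (x * q * z⁻¹) ≠ 0 := fun x hx => by
    refine qPochInf_ne_zero_of_norm_lt hq0 hq1 ?_
    rw [norm_mul, norm_mul, norm_inv, Complex.norm_real, Real.norm_of_nonneg hq0.le, mul_assoc]
    refine (mul_le_of_le_one_right (norm_nonneg _) ?_).trans_lt hx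
    rw [← div_eq_mul_inv]
    exact div_le_one_of_le₀ h1 (norm_nonneg _)
  have hpc : ∀ {f : ℂ → ℂ}, DifferentiableAt ℂ f z →
      DifferentiableAt ℂ (fun w => qPochInf q (f w)) z := fun hf => (hp _).comp z hf
  have hinv : DifferentiableAt ℂ (fun w : ℂ => w⁻¹) z := differentiableAt_inv hz
  unfold awShift
  refine DifferentiableAt.div ?_ ?_ ?_
  · exact ((differentiableAt_id.pow 3).mul (hpc (by fun_prop))).mul (hpc (hinv.pow 2))
  · exact ((((hpc (by fun_prop)).mul (hpc (by fun_prop))).mul (hpc (by fun_prop))).mul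
      (hpc (by fun_prop))).mul ((((hpc (hinv.const_mul _)).mul (hpc (hinv.const_mul _))).mul
        (hpc (hinv.const_mul _))).mul (hpc (hinv.const_mul _)))
  · simp only [ne_eq, mul_eq_zero, hout a ha, hout b hb, hout c hc, hout d hd, hin a ha, hin b hb,
      hin c hc, hin d hd, or_self, not_false_eq_true]

/-- Under `z ↦ qz` the two halves of the denominator become those of the value at `1/z`,
interchanged. In the numerator three factors of the form `1 - 1/y` turn into `1 - y`; this produces
the sign `(-1)^3`, and the powers of `z` balance because of the factor `z ^ 3` in `awShift`. -/
lemma awShift_mul_q (hq0 : 0 < q) (hq1 : q < 1) (a b c d : ℂ) {z : ℂ} (hz : z ≠ 0) :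
    awShift q a b c d (q * z) = -awShift q a b c d z⁻¹ := by
  have hq : (q : ℂ) ≠ 0 := by exact_mod_cast hq0.ne'
  have hc : ∀ x : ℂ, x * q * (q * z)⁻¹ = x * z⁻¹ := fun x => by field_simp
  have hc' : ∀ x : ℂ, x * (q * z) = x * q * z := fun x => by ring
  have h1 : qPochInf q (((q : ℂ) * z)⁻¹ ^ 2) = (1 - ((q : ℂ) * z)⁻¹ ^ 2) *
      ((1 - (q : ℂ)⁻¹ * z⁻¹ ^ 2) * ((1 - z⁻¹ ^ 2) * qPochInf q (q * z⁻¹ ^ 2))) := by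
    rw [qPochInf_eq_mul hq0 hq1, qPochInf_eq_mul hq0 hq1 (_ * _),
      show ((q : ℂ) * z)⁻¹ ^ 2 * q = (q : ℂ)⁻¹ * z⁻¹ ^ 2 by field_simp,
      show (q : ℂ)⁻¹ * z⁻¹ ^ 2 * q = z⁻¹ ^ 2 by field_simp,
      qPochInf_eq_mul hq0 hq1 (z⁻¹ ^ 2), mul_comm (z⁻¹ ^ 2) (q : ℂ)]
  have h2 : qPochInf q (z⁻¹⁻¹ ^ 2) = (1 - z ^ 2) * ((1 - q * z ^ 2) *
      ((1 - q ^ 2 * z ^ 2) * qPochInf q (q * (q * z) ^ 2))) := by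
    rw [inv_inv, qPochInf_eq_mul hq0 hq1, qPochInf_eq_mul hq0 hq1 (_ * _),
      qPochInf_eq_mul hq0 hq1 (_ * _), show z ^ 2 * (q : ℂ) = q * z ^ 2 by ring,
      show (q : ℂ) * z ^ 2 * q = q ^ 2 * z ^ 2 by ring,
      show (q : ℂ) ^ 2 * z ^ 2 * q = q * (q * z) ^ 2 by ring]
  unfold awShift
  rw [h1, h2]
  simp only [hc, hc', inv_inv, neg_div']
  rw [mul_comm (qPochInf q (a * q * z) * _ * _ * _)]
  congr 1
  field_simp
  ring

/-- The symmetrization is the Askey–Wilson integrand times a polynomial of degree one in `cos θ`; as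
its integral vanishes, it yields a linear relation between the first two moments. -/
lemma awShift_add_inv (hq0 : 0 < q) (hq1 : q < 1) {a b c d : ℂ} (ha : ‖a‖ < 1)
    (hb : ‖b‖ < 1) (hc : ‖c‖ < 1) (hd : ‖d‖ < 1) (θ : ℝ) :
    awShift q a b c d (Complex.exp (θ * Complex.I)) +
        awShift q a b c d (Complex.exp (θ * Complex.I))⁻¹ =
      ((a + b + c + d - (a * b * c + a * b * d + a * c * d + b * c * d)) -
        (1 - a * b * c * d) * (2 * (Real.cos θ : ℂ))) * nrIntegrand q a b c 0 d 0 θ := by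
  have hcos : (2 * (Real.cos θ : ℂ)) = Complex.exp (θ * Complex.I) +
      (Complex.exp (θ * Complex.I))⁻¹ := by
    rw [Complex.ofReal_cos, Complex.cos, ← Complex.exp_neg, neg_mul]; ring
  have hz1 : ‖Complex.exp (θ * Complex.I)‖ = 1 := Complex.norm_exp_ofReal_mul_I θ
  have h2 : hFun q (Real.cos (2 * θ)) 1 = qPochInf q (Complex.exp (θ * Complex.I) ^ 2) *
      qPochInf q ((Complex.exp (θ * Complex.I))⁻¹ ^ 2) := by
    rw [hFun_cos hq0 hq1, inv_pow, ← Complex.exp_nat_mul]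
    push_cast
    simp only [one_mul, mul_assoc]
  have hh := hFun_cos hq0 hq1 (θ := θ)
  rw [nrIntegrand_eq, h2, hFun_zero, hh, hh, hh, hh, hcos]
  generalize Complex.exp (θ * Complex.I) = z at *
  have hz : z ≠ 0 := norm_pos_iff.1 (by rw [hz1]; exact one_pos)
  have hn : ∀ x : ℂ, ‖x‖ < 1 → qPochInf q (x * z) ≠ 0 ∧ qPochInf q (x * z⁻¹) ≠ 0 := fun x hx =>
    ⟨qPochInf_ne_zero_of_norm_lt hq0 hq1 (by simpa [hz1] using hx),
      qPochInf_ne_zero_of_norm_lt hq0 hq1 (by simpa [hz1] using hx)⟩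
  have e : ∀ x y : ℂ, qPochInf q (x * y) = (1 - x * y) * qPochInf q (x * q * y) := fun x y => by
    rw [qPochInf_eq_mul hq0 hq1, mul_right_comm]
  have e2 : ∀ y : ℂ, qPochInf q (y ^ 2) = (1 - y ^ 2) * qPochInf q (q * y ^ 2) := fun y => by
    rw [qPochInf_eq_mul hq0 hq1, mul_comm (y ^ 2) (q : ℂ)]
  unfold awShift
  rw [inv_inv]
  simp only [e2]
  obtain ⟨a1, a2⟩ := hn a ha
  obtain ⟨b1, b2⟩ := hn b hb
  obtain ⟨c1, c2⟩ := hn c hc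
  obtain ⟨d1, d2⟩ := hn d hd
  rw [e a z, e a z⁻¹, e b z, e b z⁻¹, e c z, e c z⁻¹, e d z, e d z⁻¹]
  rw [e] at a1 a2 b1 b2 c1 c2 d1 d2
  obtain ⟨a3, a1⟩ := mul_ne_zero_iff.1 a1
  obtain ⟨a4, a2⟩ := mul_ne_zero_iff.1 a2
  obtain ⟨b3, b1⟩ := mul_ne_zero_iff.1 b1
  obtain ⟨b4, b2⟩ := mul_ne_zero_iff.1 b2
  obtain ⟨c3, c1⟩ := mul_ne_zero_iff.1 c1
  obtain ⟨c4, c2⟩ := mul_ne_zero_iff.1 c2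
  obtain ⟨d3, d1⟩ := mul_ne_zero_iff.1 d1
  obtain ⟨d4, d2⟩ := mul_ne_zero_iff.1 d2
  generalize qPochInf q (a * q * z) = A1 at *
  generalize qPochInf q (b * q * z) = B1 at *
  generalize qPochInf q (c * q * z) = C1 at *
  generalize qPochInf q (d * q * z) = D1 at *
  generalize qPochInf q (a * q * z⁻¹) = A2 at *
  generalize qPochInf q (b * q * z⁻¹) = B2 at *
  generalize qPochInf q (c * q * z⁻¹) = C2 at *
  generalize qPochInf q (d * q * z⁻¹) = D2 at *
  generalize qPochInf q (q * z ^ 2) = T1 at *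
  generalize qPochInf q (q * z⁻¹ ^ 2) = T2 at *
  -- Naming the inverse keeps it apart while the common infinite products are factored out; what
  -- remains is a rational identity in `z`.
  obtain ⟨w, hw⟩ : ∃ w, w = z⁻¹ := ⟨_, rfl⟩
  have hzw : z * w = 1 := by rw [hw, mul_inv_cancel₀ hz]
  rw [← hw] at a4 b4 c4 d4 ⊢
  have f1 : z ^ 3 * T1 * ((1 - w ^ 2) * T2) / ((1 - a * z) * A1 * ((1 - b * z) * B1) *
      ((1 - c * z) * C1) * ((1 - d * z) * D1) * (A2 * B2 * C2 * D2)) =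
      T1 * T2 / (A1 * B1 * C1 * D1 * A2 * B2 * C2 * D2) *
        (z ^ 3 * (1 - w ^ 2) / ((1 - a * z) * (1 - b * z) * (1 - c * z) * (1 - d * z))) := by
    rw [div_mul_div_comm]
    congr 1 <;> ring
  have f2 : w ^ 3 * T2 * ((1 - z ^ 2) * T1) / ((1 - a * w) * A2 * ((1 - b * w) * B2) *
      ((1 - c * w) * C2) * ((1 - d * w) * D2) * (A1 * B1 * C1 * D1)) =
      T1 * T2 / (A1 * B1 * C1 * D1 * A2 * B2 * C2 * D2) *
        (w ^ 3 * (1 - z ^ 2) / ((1 - a * w) * (1 - b * w) * (1 - c * w) * (1 - d * w))) := by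
    rw [div_mul_div_comm]
    congr 1 <;> ring
  have f3 : (1 - z ^ 2) * T1 * ((1 - w ^ 2) * T2) * 1 /
      ((1 - a * z) * A1 * ((1 - a * w) * A2) * ((1 - b * z) * B1 * ((1 - b * w) * B2)) *
        ((1 - c * z) * C1 * ((1 - c * w) * C2)) * ((1 - d * z) * D1 * ((1 - d * w) * D2)) * 1) =
      T1 * T2 / (A1 * B1 * C1 * D1 * A2 * B2 * C2 * D2) *
        ((1 - z ^ 2) * (1 - w ^ 2) / (((1 - a * z) * (1 - b * z) * (1 - c * z) * (1 - d * z)) *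
          ((1 - a * w) * (1 - b * w) * (1 - c * w) * (1 - d * w)))) := by
    rw [div_mul_div_comm]
    congr 1 <;> ring
  have g1 : (1 - a * z) * (1 - b * z) * (1 - c * z) * (1 - d * z) ≠ 0 := by
    simp only [ne_eq, mul_eq_zero, a3, b3, c3, d3, or_self, not_false_eq_true]
  have g2 : (1 - a * w) * (1 - b * w) * (1 - c * w) * (1 - d * w) ≠ 0 := by
    simp only [ne_eq, mul_eq_zero, a4, b4, c4, d4, or_self, not_false_eq_true]
  rw [f1, f2, f3, ← mul_add, mul_left_comm]
  congr 1
  rw [div_add_div _ _ g1 g2, ← mul_div_assoc]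
  congr 1
  subst hw
  field_simp
  ring

/-- The recurrence of the Askey–Wilson integral under `a ↦ a q`. -/
lemma askeyWilson_recurrence (hq0 : 0 < q) (hq1 : q < 1) {a b c d : ℂ} (ha : ‖a‖ < 1)
    (hb : ‖b‖ < 1) (hc : ‖c‖ < 1) (hd : ‖d‖ < 1) :
    (1 - a * b * c * d) * nrInt q (a * q) b c 0 d 0 =
      (1 - a * b) * (1 - a * c) * (1 - a * d) * nrInt q a b c 0 d 0 := by
  have h0 := integral_add_inv_eq_zero (F := awShift q a b c d) hq0 hq1.le
    (fun z h1 h2 => differentiableAt_awShift hq0 hq1 ha hb hc hd h1 h2)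
    (fun z hz => awShift_mul_q hq0 hq1 a b c d (norm_pos_iff.1 (by rw [hz]; exact one_pos)))
  simp only [awShift_add_inv hq0 hq1 ha hb hc hd] at h0
  have hz : ‖(0 : ℂ)‖ < 1 := by simp
  have hi := continuous_nrIntegrand hq0 hq1 0 ha hb hc hd hz
  have hi' := continuous_nrIntegrand hq0 hq1 0 (norm_mul_ofReal_lt hq0 hq1 ha) hb hc hd hz
  have hs : ∀ θ, nrIntegrand q (a * q) b c 0 d 0 θ =
      (1 - 2 * a * (Real.cos θ : ℂ) + a ^ 2) * nrIntegrand q a b c 0 d 0 θ := fun θ => by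
    have := nrIntegrand_mul_q hq0 hq1 (a := d) (b := b) (c := c) (v := 0) 0 ha θ
    rw [nrIntegrand_eq] at this ⊢
    rw [nrIntegrand_eq] at this ⊢
    convert this using 2 <;> ring
  rw [← sub_eq_zero]
  unfold nrInt
  rw [← intervalIntegral.integral_const_mul, ← intervalIntegral.integral_const_mul,
    ← intervalIntegral.integral_sub ((hi'.const_mul _).intervalIntegrable _ _)
      ((hi.const_mul _).intervalIntegrable _ _)]
  -- `(1 - abcd)(1 - 2ax + a²) - (1 - ab)(1 - ac)(1 - ad)` is `a` times the linear factor found in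
  -- `awShift_add_inv`.
  refine Eq.trans ?_ ((congrArg (a * ·) h0).trans (mul_zero a))
  rw [← intervalIntegral.integral_const_mul]
  refine intervalIntegral.integral_congr fun θ _ => ?_
  rw [hs]
  ring

/-! ### Sending the Askey–Wilson parameters to zero -/

lemma tendsto_ofReal_pow_zero (hq0 : 0 < q) (hq1 : q < 1) (x : ℂ) :
    Tendsto (fun n : ℕ => x * (q : ℂ) ^ n) atTop (𝓝 0) := by
  have h : ‖(q : ℂ)‖ < 1 := by rwa [Complex.norm_real, Real.norm_of_nonneg hq0.le]
  simpa using (tendsto_pow_atTop_nhds_zero_of_norm_lt_one h).const_mul x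

lemma norm_mul_lt_one {x y : ℂ} (hx : ‖x‖ < 1) (hy : ‖y‖ < 1) : ‖x * y‖ < 1 := by
  rw [norm_mul]
  exact mul_lt_one_of_nonneg_of_lt_one_left (norm_nonneg _) hx hy.le

/-- By the recurrence the quotient `H` is invariant under `x ↦ xq`; being continuous at `0`, it
satisfies `H a = H 0`. -/
lemma askeyWilson_reduce (hq0 : 0 < q) (hq1 : q < 1) {a b c d : ℂ} (ha : ‖a‖ < 1)
    (hb : ‖b‖ < 1) (hc : ‖c‖ < 1) (hd : ‖d‖ < 1) :
    nrInt q a b c 0 d 0 * (qPochInf q (a * b) * qPochInf q (a * c) * qPochInf q (a * d)) =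
      qPochInf q (a * b * c * d) * nrInt q 0 b c 0 d 0 := by
  have hz : ‖(0 : ℂ)‖ < 1 := by simp
  have hn : ∀ x : ℂ, ‖x‖ < 1 → ‖x * b * c * d‖ < 1 := fun x hx =>
    norm_mul_lt_one (norm_mul_lt_one (norm_mul_lt_one hx hb) hc) hd
  set H : ℂ → ℂ := fun x => nrInt q x b c 0 d 0 *
    (qPochInf q (x * b) * qPochInf q (x * c) * qPochInf q (x * d)) / qPochInf q (x * b * c * d)
    with hH
  have hstep : ∀ x : ℂ, ‖x‖ < 1 → H (x * q) = H x := by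
    intro x hx
    have e : ∀ y : ℂ, qPochInf q (x * y) = (1 - x * y) * qPochInf q (x * q * y) := fun y => by
      rw [qPochInf_eq_mul hq0 hq1, mul_right_comm]
    have e' : qPochInf q (x * b * c * d) =
        (1 - x * b * c * d) * qPochInf q (x * q * b * c * d) := by
      rw [qPochInf_eq_mul hq0 hq1]; ring_nf
    have n1 := qPochInf_ne_zero_of_norm_lt hq0 hq1 (hn x hx)
    have n2 := qPochInf_ne_zero_of_norm_lt hq0 hq1 (hn _ (norm_mul_ofReal_lt hq0 hq1 hx))
    simp only [hH]
    rw [div_eq_div_iff n2 n1, e', e, e, e]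
    linear_combination (qPochInf q (x * q * b) * qPochInf q (x * q * c) * qPochInf q (x * q * d) *
      qPochInf q (x * q * b * c * d)) * askeyWilson_recurrence hq0 hq1 hx hb hc hd
  have hpow : ∀ n : ℕ, H (a * (q : ℂ) ^ n) = H a ∧ ‖a * (q : ℂ) ^ n‖ < 1 := by
    intro n
    induction n with
    | zero => simpa using ha
    | succ n ih =>
      rw [pow_succ, ← mul_assoc]
      exact ⟨(hstep _ ih.2).trans ih.1, norm_mul_ofReal_lt hq0 hq1 ih.2⟩
  have hcont : ContinuousAt H 0 := by
    have hp := (differentiable_qPochInf hq0 hq1).continuous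
    refine ContinuousAt.div (ContinuousAt.mul ?_ (Continuous.continuousAt ?_))
      (Continuous.continuousAt (hp.comp (by fun_prop))) (by simp)
    · exact ((differentiableOn_nrInt_left hq0 hq1 0 hb hc hd hz).differentiableAt
        (Metric.isOpen_ball.mem_nhds (by simp))).continuousAt
    · exact ((hp.comp (by fun_prop)).mul (hp.comp (by fun_prop))).mul (hp.comp (by fun_prop))
  have hlim := hcont.tendsto.comp (tendsto_ofReal_pow_zero hq0 hq1 a)
  have hfin : H a = H 0 :=
    tendsto_nhds_unique (tendsto_const_nhds.congr fun n => (hpow n).1.symm) hlim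
  simp only [hH, zero_mul, qPochInf_zero, mul_one, div_one] at hfin
  rw [div_eq_iff (qPochInf_ne_zero_of_norm_lt hq0 hq1 (hn a ha))] at hfin
  rw [hfin, mul_comm]

lemma askeyWilson_eq_const_mul (hq0 : 0 < q) (hq1 : q < 1) {a b c d : ℂ} (ha : ‖a‖ < 1)
    (hb : ‖b‖ < 1) (hc : ‖c‖ < 1) (hd : ‖d‖ < 1) :
    nrInt q a b c 0 d 0 * (qPochInf q (a * b) * qPochInf q (a * c) * qPochInf q (a * d) *
        qPochInf q (b * c) * qPochInf q (b * d) * qPochInf q (c * d)) =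
      qPochInf q (a * b * c * d) * nrInt q 0 0 0 0 0 0 := by
  have hz : ‖(0 : ℂ)‖ < 1 := by simp
  have h1 := askeyWilson_reduce hq0 hq1 ha hb hc hd
  -- Once one parameter is `0`, the product of all four vanishes, so the later reductions contribute
  -- only pair products.
  have h2 := askeyWilson_reduce hq0 hq1 hb hz hc hd
  have h3 := askeyWilson_reduce hq0 hq1 hc hz hz hd
  have h4 := askeyWilson_reduce hq0 hq1 hd hz hz hz
  rw [nrInt_swap_left b 0] at h2
  rw [nrInt_swap_left c 0, nrInt_swap_middle 0 c 0] at h3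
  rw [nrInt_swap_left d 0, nrInt_swap_middle 0 d 0, nrInt_swap_cu 0 0 d] at h4
  simp only [mul_zero, zero_mul, qPochInf_zero, one_mul, mul_one] at h2 h3 h4
  linear_combination (qPochInf q (b * c) * qPochInf q (b * d) * qPochInf q (c * d)) * h1 +
    qPochInf q (a * b * c * d) * (qPochInf q (c * d) * h2 + h3 + h4)

/-- Euler's identity `(-q; q)_∞ (q; q²)_∞ = 1`. -/
lemma qPochInf_neg_mul_sq (hq0 : 0 < q) (hq1 : q < 1) :
    qPochInf q (-q) * qPochInf (q ^ 2) q = 1 := by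
  have hq : ‖(q : ℂ)‖ < 1 := by rwa [Complex.norm_real, Real.norm_of_nonneg hq0.le]
  have h1 := qPochInf_sq_mul hq0 hq1 (q : ℂ)
  have h2 := qPochInf_mul_neg hq0 hq1 (q : ℂ)
  rw [← sq, ← h2] at h1
  refine mul_left_cancel₀ (qPochInf_ne_zero_of_norm_lt hq0 hq1 hq) ?_
  linear_combination h1

/-- The parameters `q, -q, √q, -√q` are chosen because `(qx, -qx, √q x, -√q x; q)_∞ = (q x²; q)_∞`:
the denominator cancels all of `h(cos 2θ; 1)` except its factor `k = 0`, which is `2 - 2 cos 2θ`. -/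
lemma nrInt_zero_mul (hq0 : 0 < q) (hq1 : q < 1) :
    qPochInf q q * nrInt q 0 0 0 0 0 0 = 2 * (Real.pi : ℂ) := by
  set s : ℂ := (Real.sqrt q : ℂ) with hs
  have hs2 : s ^ 2 = q := by rw [hs]; exact_mod_cast Real.sq_sqrt hq0.le
  have hq : ‖(q : ℂ)‖ < 1 := by rwa [Complex.norm_real, Real.norm_of_nonneg hq0.le]
  have hs1 : ‖s‖ < 1 := by
    rw [hs, Complex.norm_real, Real.norm_of_nonneg (Real.sqrt_nonneg _), Real.sqrt_lt' one_pos]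
    simpa using hq1
  have hquad : ∀ x : ℂ, qPochInf q (q * x) * qPochInf q (-q * x) * qPochInf q (s * x) *
      qPochInf q (-s * x) = qPochInf q (q * x ^ 2) := by
    intro x
    rw [neg_mul, neg_mul, qPochInf_mul_neg hq0 hq1, mul_assoc, qPochInf_mul_neg hq0 hq1,
      ← qPochInf_sq_mul hq0 hq1, mul_pow, mul_pow, hs2, mul_comm,
      show (q : ℂ) ^ 2 * x ^ 2 = q * x ^ 2 * q by ring]
  have hint : nrInt q q (-q) s 0 (-s) 0 = 2 * (Real.pi : ℂ) := by
    have hfun : ∀ θ : ℝ, nrIntegrand q q (-q) s 0 (-s) 0 θ =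
        ((2 - 2 * Real.cos (2 * θ) : ℝ) : ℂ) := by
      intro θ
      have n1 := hFun_cos_ne_zero hq0 hq1 hq θ
      have n2 := hFun_cos_ne_zero hq0 hq1 (a := -q) (by simpa using hq) θ
      have n3 := hFun_cos_ne_zero hq0 hq1 hs1 θ
      have n4 := hFun_cos_ne_zero hq0 hq1 (a := -s) (by simpa using hs1) θ
      rw [nrIntegrand_eq, hFun_zero, div_eq_iff (by simp only [ne_eq, mul_eq_zero, n1, n2, n3, n4,
        one_ne_zero, or_self, not_false_eq_true])]
      rw [hFun_cos_eq_mul hq0 hq1 1 (2 * θ)]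
      have hq2 : hFun q (Real.cos (2 * θ)) (1 * q) = hFun q (Real.cos θ) q *
          hFun q (Real.cos θ) (-q) * hFun q (Real.cos θ) s * hFun q (Real.cos θ) (-s) := by
        simp only [hFun_cos hq0 hq1]
        have ez : Complex.exp ((2 * θ : ℝ) * Complex.I) = Complex.exp (θ * Complex.I) ^ 2 := by
          rw [← Complex.exp_nat_mul]; push_cast; ring_nf
        rw [ez, ← inv_pow, one_mul, ← hquad, ← hquad]
        ring
      rw [hq2]
      push_cast
      ring
    unfold nrInt
    simp only [hfun]
    rw [intervalIntegral.integral_ofReal, intervalIntegral.integral_sub (by simp)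
      (Continuous.intervalIntegrable (by fun_prop) _ _), intervalIntegral.integral_const_mul,
      intervalIntegral.integral_comp_mul_left (fun x => Real.cos x) two_ne_zero]
    simp
    ring
  have key := askeyWilson_eq_const_mul hq0 hq1 (a := q) (b := -q) (c := s) (d := -s) hq
    (by simpa using hq) hs1 (by simpa using hs1)
  have hsq : qPochInf q (q * s) * qPochInf q (-(q * s)) = qPochInf (q ^ 2) (q * (q : ℂ) ^ 2) := by
    rw [qPochInf_mul_neg hq0 hq1, mul_pow, hs2, mul_comm]
  have hE := qPochInf_neg_mul_sq hq0 hq1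
  have e1 : qPochInf (q ^ 2) q = (1 - q) * qPochInf (q ^ 2) (q * (q : ℂ) ^ 2) := by
    have := qPochInf_eq_mul (pow_pos hq0 2) (by nlinarith) (q : ℂ)
    push_cast at this
    exact this
  have e2 : qPochInf q (-q) = (1 + q) * qPochInf q (-(q : ℂ) ^ 2) := by
    rw [qPochInf_eq_mul hq0 hq1, sub_neg_eq_add, neg_mul, ← sq]
  have e3 : qPochInf q q = (1 - q) * ((1 - (q : ℂ) ^ 2) * qPochInf q ((q : ℂ) ^ 3)) := by
    rw [qPochInf_eq_mul hq0 hq1, qPochInf_eq_mul hq0 hq1 ((q : ℂ) * q), ← sq, ← pow_succ]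
  rw [hint] at key
  have p1 : (q : ℂ) * -q = -(q : ℂ) ^ 2 := by ring
  have p2 : (q : ℂ) * -s = -(q * s) := by ring
  have p3 : -(q : ℂ) * s = -(q * s) := by ring
  have p4 : -(q : ℂ) * -s = q * s := by ring
  have p5 : s * -s = -(q : ℂ) := by linear_combination -hs2
  have p6 : -(q : ℂ) ^ 2 * s * -s = (q : ℂ) ^ 3 := by linear_combination (q : ℂ) ^ 2 * hs2
  rw [p1, p2, p3, p4, p5, p6] at key
  generalize nrInt q 0 0 0 0 0 0 = I0 at *
  generalize qPochInf q (q * s) = S1 at *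
  generalize qPochInf q (-(q * s)) = S2 at *
  generalize qPochInf (q ^ 2) (q * (q : ℂ) ^ 2) = T at *
  generalize qPochInf q (-(q : ℂ) ^ 2) = N at *
  rw [e3]
  -- With `S1 * S2 = T`, the claim becomes `2π` times the square of this form of Euler's identity.
  have hE' : (1 + q) * N * ((1 - q) * T) = 1 := by rw [← e1, ← e2, hE]
  rw [e2] at key
  linear_combination -(1 - (q : ℂ)) * (1 - (q : ℂ) ^ 2) * key +
    2 * (Real.pi : ℂ) * ((1 + q) * N * ((1 - q) * T) + 1) * hE' +
    (1 - (q : ℂ)) * (1 - (q : ℂ) ^ 2) * 2 * Real.pi * N * (1 + q) * N * (S1 * S2 + T) * hsq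

/-- The **Askey–Wilson integral**. -/
theorem askeyWilson_integral (hq0 : 0 < q) (hq1 : q < 1) {a b c d : ℂ} (ha : ‖a‖ < 1)
    (hb : ‖b‖ < 1) (hc : ‖c‖ < 1) (hd : ‖d‖ < 1) :
    nrInt q a b c 0 d 0 * (qPochInf q q * qPochInf q (a * b) * qPochInf q (a * c) *
        qPochInf q (a * d) * qPochInf q (b * c) * qPochInf q (b * d) * qPochInf q (c * d)) =
      2 * (Real.pi : ℂ) * qPochInf q (a * b * c * d) := by
  linear_combination qPochInf q q * askeyWilson_eq_const_mul hq0 hq1 ha hb hc hd +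
    qPochInf q (a * b * c * d) * nrInt_zero_mul hq0 hq1

end AskeyWilson

/-! ### The very-well-poised series, normalized to be holomorphic in its parameters -/

section NormalizedSeries

variable {q : ℝ}

/-- The term `nrTerm` multiplied by `(cd, bd, ad, abcu, abcv; q)_∞`. -/
def nrNormTerm (q : ℝ) (a b c d u v : ℂ) (n : ℕ) : ℂ :=
  vwpFactor q (a * b * c * d) n * (qPoch q (a * b) n * qPoch q (a * c) n * qPoch q (b * c) n) *
    ((∏ k ∈ Finset.range n, (u - d * (q : ℂ) ^ k)) *
      ∏ k ∈ Finset.range n, (v - d * (q : ℂ) ^ k)) *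
    (qPochInf q (c * d * (q : ℂ) ^ n) * qPochInf q (b * d * (q : ℂ) ^ n) *
      qPochInf q (a * d * (q : ℂ) ^ n) * qPochInf q (a * b * c * u * (q : ℂ) ^ n) *
      qPochInf q (a * b * c * v * (q : ℂ) ^ n)) / qPoch q q n

lemma nrNormTerm_swap (a b c d u v : ℂ) (n : ℕ) :
    nrNormTerm q a b c d u v n = nrNormTerm q a b c d v u n := by
  unfold nrNormTerm
  ring

lemma norm_ofReal_pow_le_one (hq0 : 0 < q) (hq1 : q < 1) (n : ℕ) : ‖(q : ℂ) ^ n‖ ≤ 1 := by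
  rw [norm_pow, Complex.norm_real, Real.norm_of_nonneg hq0.le]
  exact pow_le_one₀ hq0.le hq1.le

lemma norm_qPoch_le_of_le (hq0 : 0 < q) (hq1 : q < 1) {x : ℂ} {B : ℝ} (hx : ‖x‖ ≤ B) (n : ℕ) :
    ‖qPoch q x n‖ ≤ Real.exp (B / (1 - q)) := by
  have : 0 < 1 - q := by linarith
  exact (norm_qPoch_le hq0 hq1 x n).trans (Real.exp_le_exp.2 (by gcongr))

lemma norm_qPochInf_mul_pow_le (hq0 : 0 < q) (hq1 : q < 1) {x : ℂ} {B : ℝ} (hx : ‖x‖ ≤ B)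
    (n : ℕ) : ‖qPochInf q (x * (q : ℂ) ^ n)‖ ≤ Real.exp (B / (1 - q)) := by
  have h1 : 0 < 1 - q := by linarith
  have h2 : ‖x * (q : ℂ) ^ n‖ ≤ B := by
    rw [norm_mul]
    exact (mul_le_of_le_one_right (norm_nonneg _) (norm_ofReal_pow_le_one hq0 hq1 n)).trans hx
  exact (norm_qPochInf_le hq0 hq1 _).trans (Real.exp_le_exp.2 (by gcongr))

/-- Each factor is at most `r (1 + (D / r) q^k)`. A positive `r` in place of `‖u‖` gives a geometric
rate uniform in `u`, including `u = 0`. -/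
lemma norm_prod_sub_mul_pow_le (hq0 : 0 < q) (hq1 : q < 1) {u d : ℂ} {r D : ℝ} (hr : 0 < r)
    (hu : ‖u‖ ≤ r) (hd : ‖d‖ ≤ D) (n : ℕ) :
    ‖∏ k ∈ Finset.range n, (u - d * (q : ℂ) ^ k)‖ ≤ Real.exp (D / r / (1 - q)) * r ^ n := by
  have hD : 0 ≤ D := (norm_nonneg d).trans hd
  have h1 : ‖∏ k ∈ Finset.range n, (u - d * (q : ℂ) ^ k)‖ ≤
      ∏ k ∈ Finset.range n, ((1 + D / r * q ^ k) * r) := by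
    rw [norm_prod]
    refine Finset.prod_le_prod (fun _ _ => norm_nonneg _) fun k _ => ?_
    refine (norm_sub_le _ _).trans ?_
    rw [norm_mul, norm_pow, Complex.norm_real, Real.norm_of_nonneg hq0.le,
      show (1 + D / r * q ^ k) * r = r + D * q ^ k by field_simp]
    gcongr
  refine h1.trans ?_
  rw [Finset.prod_mul_distrib, Finset.prod_const, Finset.card_range]
  gcongr
  refine (Real.prod_one_add_le_exp_sum _ fun k => by positivity).trans (Real.exp_le_exp.2 ?_)
  rw [← Finset.mul_sum, div_eq_mul_inv _ (1 - q), ← tsum_geometric_of_lt_one hq0.le hq1]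
  gcongr
  exact (summable_geometric_of_lt_one hq0.le hq1).sum_le_tsum _ fun k _ => by positivity

lemma norm_ofReal_lt_one (hq0 : 0 < q) (hq1 : q < 1) : ‖(q : ℂ)‖ < 1 := by
  rwa [Complex.norm_real, Real.norm_of_nonneg hq0.le]

/-- `1 / (q; q)_n` is the tail `(q^{n+1}; q)_∞` over `(q; q)_∞`, and the tails are bounded. -/
lemma exists_norm_inv_qPoch_self_le (hq0 : 0 < q) (hq1 : q < 1) :
    ∃ K : ℝ, 0 ≤ K ∧ ∀ n, ‖(qPoch q q n)⁻¹‖ ≤ K := by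
  have hn := norm_ofReal_lt_one hq0 hq1
  refine ⟨Real.exp (1 / (1 - q)) / ‖qPochInf q q‖, by positivity, fun n => ?_⟩
  have h0 := qPochInf_ne_zero_of_norm_lt hq0 hq1 hn
  have h1 := qPoch_ne_zero (mul_pow_ne_one hq0 hq1 hn) n
  have h2 : (qPoch q q n)⁻¹ = qPochInf q (q * (q : ℂ) ^ n) / qPochInf q q := by
    rw [eq_div_iff h0, qPochInf_eq_qPoch_mul hq0 hq1 (q : ℂ) n, inv_mul_cancel_left₀ h1]
  rw [h2, norm_div]
  gcongr
  exact norm_qPochInf_mul_pow_le hq0 hq1 hn.le n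

lemma norm_vwpFactor_le (hq0 : 0 < q) (hq1 : q < 1) {e : ℂ} {B : ℝ} (he : ‖e‖ ≤ B) (n : ℕ) :
    ‖vwpFactor q e n‖ ≤ (1 + B) * Real.exp (B / (1 - q)) := by
  have hB : 0 ≤ B := (norm_nonneg _).trans he
  have h1 : 0 < 1 - q := by linarith
  cases n with
  | zero =>
    have : 1 ≤ Real.exp (B / (1 - q)) := Real.one_le_exp (by positivity)
    rw [vwpFactor, norm_one]
    nlinarith
  | succ n =>
    rw [vwpFactor, norm_mul]
    refine mul_le_mul ?_ (norm_qPoch_le_of_le hq0 hq1 he n) (norm_nonneg _) (by positivity)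
    refine (norm_sub_le _ _).trans ?_
    rw [norm_one, norm_mul]
    have := mul_le_of_le_one_right (norm_nonneg e) (norm_ofReal_pow_le_one hq0 hq1 (2 * n + 1))
    linarith

/-- A majorant uniform in `d`, `u`, `v`; with `r < 1` it serves the Weierstrass test for both
convergence and holomorphy. -/
lemma exists_norm_nrNormTerm_le (hq0 : 0 < q) (hq1 : q < 1) (a b c : ℂ) {r : ℝ} (hr : 0 < r)
    (D : ℝ) : ∃ K : ℝ, ∀ d u v : ℂ, ‖d‖ ≤ D → ‖u‖ ≤ r → ‖v‖ ≤ r → ∀ n,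
      ‖nrNormTerm q a b c d u v n‖ ≤ K * (r * r) ^ n := by
  obtain ⟨K, hK0, hK⟩ := exists_norm_inv_qPoch_self_le hq0 hq1
  refine ⟨(1 + ‖a * b * c‖ * D) * Real.exp (‖a * b * c‖ * D / (1 - q)) *
    (Real.exp (‖a * b‖ / (1 - q)) * Real.exp (‖a * c‖ / (1 - q)) * Real.exp (‖b * c‖ / (1 - q))) *
    (Real.exp (D / r / (1 - q)) * Real.exp (D / r / (1 - q))) *
    (Real.exp (‖c‖ * D / (1 - q)) * Real.exp (‖b‖ * D / (1 - q)) * Real.exp (‖a‖ * D / (1 - q)) *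
      Real.exp (‖a * b * c‖ * r / (1 - q)) * Real.exp (‖a * b * c‖ * r / (1 - q))) * K,
    fun d u v hd hu hv n => ?_⟩
  have hD : 0 ≤ D := (norm_nonneg d).trans hd
  have hm : ∀ {x y : ℂ} {B : ℝ}, ‖y‖ ≤ B → ‖x * y‖ ≤ ‖x‖ * B := fun h => by
    rw [norm_mul]; gcongr
  have e1 := norm_vwpFactor_le hq0 hq1 (hm (x := a * b * c) hd) n
  have e2 := norm_qPoch_le hq0 hq1 (a * b) n
  have e3 := norm_qPoch_le hq0 hq1 (a * c) n
  have e4 := norm_qPoch_le hq0 hq1 (b * c) n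
  have e5 := norm_prod_sub_mul_pow_le hq0 hq1 hr hu hd n
  have e6 := norm_prod_sub_mul_pow_le hq0 hq1 hr hv hd n
  have e7 := norm_qPochInf_mul_pow_le hq0 hq1 (hm (x := c) hd) n
  have e8 := norm_qPochInf_mul_pow_le hq0 hq1 (hm (x := b) hd) n
  have e9 := norm_qPochInf_mul_pow_le hq0 hq1 (hm (x := a) hd) n
  have e10 := norm_qPochInf_mul_pow_le hq0 hq1 (hm (x := a * b * c) hu) n
  have e11 := norm_qPochInf_mul_pow_le hq0 hq1 (hm (x := a * b * c) hv) n
  have e12 := hK n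
  unfold nrNormTerm
  rw [div_eq_mul_inv]
  simp only [norm_mul _ (_ : ℂ)] at *
  calc _ ≤ (1 + ‖a‖ * ‖b‖ * ‖c‖ * D) * Real.exp (‖a‖ * ‖b‖ * ‖c‖ * D / (1 - q)) *
    (Real.exp (‖a‖ * ‖b‖ / (1 - q)) * Real.exp (‖a‖ * ‖c‖ / (1 - q)) *
      Real.exp (‖b‖ * ‖c‖ / (1 - q))) *
    ((Real.exp (D / r / (1 - q)) * r ^ n) * (Real.exp (D / r / (1 - q)) * r ^ n)) *
    (Real.exp (‖c‖ * D / (1 - q)) * Real.exp (‖b‖ * D / (1 - q)) * Real.exp (‖a‖ * D / (1 - q)) *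
      Real.exp (‖a‖ * ‖b‖ * ‖c‖ * r / (1 - q)) * Real.exp (‖a‖ * ‖b‖ * ‖c‖ * r / (1 - q))) * K := by
        gcongr
    _ = _ := by rw [mul_pow]; ring

lemma summable_nrNormTerm (hq0 : 0 < q) (hq1 : q < 1) (a b c d : ℂ) {u v : ℂ}
    (hu : ‖u‖ < 1) (hv : ‖v‖ < 1) : Summable (nrNormTerm q a b c d u v) := by
  obtain ⟨r, hr, hr1⟩ := exists_between (max_lt (max_lt hu hv) one_pos)
  simp only [max_lt_iff] at hr
  obtain ⟨K, hK⟩ := exists_norm_nrNormTerm_le hq0 hq1 a b c hr.2 ‖d‖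
  refine Summable.of_norm_bounded ?_ (hK d u v le_rfl hr.1.1.le hr.1.2.le)
  exact (summable_geometric_of_lt_one (by nlinarith) (by nlinarith)).mul_left K

lemma differentiable_qPoch (n : ℕ) : Differentiable ℂ fun x => qPoch q x n := by
  unfold qPoch
  fun_prop

lemma differentiable_vwpFactor (n : ℕ) : Differentiable ℂ fun x => vwpFactor q x n := by
  cases n with
  | zero => simp only [vwpFactor]; fun_prop
  | succ n =>
    have := differentiable_qPoch (q := q) n
    simp only [vwpFactor]
    fun_prop

lemma differentiable_nrNormTerm (hq0 : 0 < q) (hq1 : q < 1) (a b c : ℂ) {δ μ ν : ℂ → ℂ}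
    (hδ : Differentiable ℂ δ) (hμ : Differentiable ℂ μ) (hν : Differentiable ℂ ν) (n : ℕ) :
    Differentiable ℂ fun w => nrNormTerm q a b c (δ w) (μ w) (ν w) n := by
  have h1 : ∀ {f : ℂ → ℂ}, Differentiable ℂ f → Differentiable ℂ fun w => qPochInf q (f w) :=
    fun hf => (differentiable_qPochInf hq0 hq1).comp hf
  have h2 : Differentiable ℂ fun w => vwpFactor q (a * b * c * δ w) n :=
    (differentiable_vwpFactor n).comp (by fun_prop)
  unfold nrNormTerm
  refine Differentiable.div_const (((h2.mul_const _).mul (by fun_prop)).mul ?_) _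
  exact ((((h1 (by fun_prop)).mul (h1 (by fun_prop))).mul (h1 (by fun_prop))).mul
    (h1 (by fun_prop))).mul (h1 (by fun_prop))

lemma differentiableOn_tsum_nrNormTerm (hq0 : 0 < q) (hq1 : q < 1) (a b c d : ℂ) {u : ℂ}
    (hu : ‖u‖ < 1) :
    DifferentiableOn ℂ (fun v => ∑' n, nrNormTerm q a b c d u v n) (Metric.ball 0 1) := by
  intro v hv
  have hv : ‖v‖ < 1 := by simpa using hv
  obtain ⟨r, hr, hr1⟩ := exists_between (max_lt (max_lt hu hv) one_pos)
  simp only [max_lt_iff] at hr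
  obtain ⟨K, hK⟩ := exists_norm_nrNormTerm_le hq0 hq1 a b c hr.2 ‖d‖
  have h := Complex.differentiableOn_tsum_of_summable_norm (U := Metric.ball 0 r)
    (F := fun n v => nrNormTerm q a b c d u v n)
    ((summable_geometric_of_lt_one (by nlinarith) (by nlinarith)).mul_left K)
    (fun n => (differentiable_nrNormTerm hq0 hq1 a b c (by fun_prop) (by fun_prop)
      (by fun_prop) n).differentiableOn) Metric.isOpen_ball
    (fun n w hw => hK d u w le_rfl hr.1.1.le (by simpa using (Metric.mem_ball.1 hw).le) n)
  exact (h.differentiableAt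
    (Metric.isOpen_ball.mem_nhds (by simpa using hr.1.2))).differentiableWithinAt

lemma differentiable_tsum_nrNormTerm (hq0 : 0 < q) (hq1 : q < 1) (a b c : ℂ) {u v : ℂ}
    (hu : ‖u‖ < 1) (hv : ‖v‖ < 1) :
    Differentiable ℂ (fun d => ∑' n, nrNormTerm q a b c d u v n) := by
  intro d
  obtain ⟨r, hr, hr1⟩ := exists_between (max_lt (max_lt hu hv) one_pos)
  simp only [max_lt_iff] at hr
  obtain ⟨K, hK⟩ := exists_norm_nrNormTerm_le hq0 hq1 a b c hr.2 (‖d‖ + 1)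
  have h := Complex.differentiableOn_tsum_of_summable_norm (U := Metric.ball 0 (‖d‖ + 1))
    (F := fun n d => nrNormTerm q a b c d u v n)
    ((summable_geometric_of_lt_one (by nlinarith) (by nlinarith)).mul_left K)
    (fun n => (differentiable_nrNormTerm hq0 hq1 a b c (by fun_prop) (by fun_prop)
      (by fun_prop) n).differentiableOn) Metric.isOpen_ball
    (fun n w hw => hK w u v (by simpa using (Metric.mem_ball.1 hw).le) hr.1.1.le hr.1.2.le n)
  exact h.differentiableAt (Metric.isOpen_ball.mem_nhds (by simp))

/-! ### The contiguous relation of the series, by telescoping -/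

/-- The antidifference certifying the contiguous relation of the normalized series. -/
def nrCert (q : ℝ) (a b c d u v : ℂ) (m : ℕ) : ℂ :=
  u * v * (v - u) * (qPoch q (a * b * c * d) m * (qPoch q (a * b) (m + 1) *
    qPoch q (a * c) (m + 1) * qPoch q (b * c) (m + 1)) *
    ((∏ k ∈ Finset.range m, (u - d * (q : ℂ) ^ k)) *
      ∏ k ∈ Finset.range m, (v - d * (q : ℂ) ^ k)) *
    (qPochInf q (c * d * (q : ℂ) ^ m) * qPochInf q (b * d * (q : ℂ) ^ m) *
      qPochInf q (a * d * (q : ℂ) ^ m) * qPochInf q (a * b * c * u * (q : ℂ) ^ (m + 1)) *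
      qPochInf q (a * b * c * v * (q : ℂ) ^ (m + 1))) / qPoch q q m)

lemma tendsto_nrCert (hq0 : 0 < q) (hq1 : q < 1) (a b c d : ℂ) {u v : ℂ}
    (hu : ‖u‖ < 1) (hv : ‖v‖ < 1) : Tendsto (nrCert q a b c d u v) atTop (𝓝 0) := by
  obtain ⟨r, hr, hr1⟩ := exists_between (max_lt (max_lt hu hv) one_pos)
  simp only [max_lt_iff] at hr
  obtain ⟨⟨hur, hvr⟩, hr0⟩ := hr
  obtain ⟨K, hK0, hK⟩ := exists_norm_inv_qPoch_self_le hq0 hq1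
  set C : ℝ := ‖u * v * (v - u)‖ * (Real.exp (‖a * b * c * d‖ / (1 - q)) *
    (Real.exp (‖a * b‖ / (1 - q)) * Real.exp (‖a * c‖ / (1 - q)) * Real.exp (‖b * c‖ / (1 - q))) *
    (Real.exp (‖d‖ / r / (1 - q)) * Real.exp (‖d‖ / r / (1 - q))) *
    (Real.exp (‖c * d‖ / (1 - q)) * Real.exp (‖b * d‖ / (1 - q)) * Real.exp (‖a * d‖ / (1 - q)) *
      Real.exp (‖a * b * c * u‖ / (1 - q)) * Real.exp (‖a * b * c * v‖ / (1 - q))) * K) with hC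
  have hb : ∀ m, ‖nrCert q a b c d u v m‖ ≤ C * (r * r) ^ m := by
    intro m
    have e1 := norm_qPoch_le hq0 hq1 (a * b * c * d) m
    have e2 := norm_qPoch_le hq0 hq1 (a * b) (m + 1)
    have e3 := norm_qPoch_le hq0 hq1 (a * c) (m + 1)
    have e4 := norm_qPoch_le hq0 hq1 (b * c) (m + 1)
    have e5 := norm_prod_sub_mul_pow_le hq0 hq1 hr0 hur.le le_rfl (d := d) m
    have e6 := norm_prod_sub_mul_pow_le hq0 hq1 hr0 hvr.le le_rfl (d := d) m
    have e7 := norm_qPochInf_mul_pow_le hq0 hq1 (le_refl ‖c * d‖) m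
    have e8 := norm_qPochInf_mul_pow_le hq0 hq1 (le_refl ‖b * d‖) m
    have e9 := norm_qPochInf_mul_pow_le hq0 hq1 (le_refl ‖a * d‖) m
    have e10 := norm_qPochInf_mul_pow_le hq0 hq1 (le_refl ‖a * b * c * u‖) (m + 1)
    have e11 := norm_qPochInf_mul_pow_le hq0 hq1 (le_refl ‖a * b * c * v‖) (m + 1)
    have e12 := hK m
    unfold nrCert
    rw [norm_mul, div_eq_mul_inv, norm_mul _ (qPoch q q m)⁻¹, norm_mul _ (_ * qPochInf q _),
      norm_mul _ (_ * ∏ k ∈ Finset.range m, _), norm_mul _ (_ * qPoch q _ _),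
      norm_mul _ (qPoch q (b * c) _), norm_mul (qPoch q (a * b) _),
      norm_mul (∏ k ∈ Finset.range m, _), norm_mul _ (qPochInf q (a * b * c * v * _)),
      norm_mul _ (qPochInf q (a * b * c * u * _)), norm_mul _ (qPochInf q (a * d * _)),
      norm_mul (qPochInf q (c * d * _))]
    calc _ ≤ ‖u * v * (v - u)‖ * (Real.exp (‖a * b * c * d‖ / (1 - q)) *
      (Real.exp (‖a * b‖ / (1 - q)) * Real.exp (‖a * c‖ / (1 - q)) *
        Real.exp (‖b * c‖ / (1 - q))) *
      ((Real.exp (‖d‖ / r / (1 - q)) * r ^ m) * (Real.exp (‖d‖ / r / (1 - q)) * r ^ m)) *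
      (Real.exp (‖c * d‖ / (1 - q)) * Real.exp (‖b * d‖ / (1 - q)) *
        Real.exp (‖a * d‖ / (1 - q)) * Real.exp (‖a * b * c * u‖ / (1 - q)) *
        Real.exp (‖a * b * c * v‖ / (1 - q))) * K) := by gcongr
      _ = _ := by rw [hC, mul_pow]; ring
  refine squeeze_zero_norm hb ?_
  simpa using (tendsto_pow_atTop_nhds_zero_of_lt_one (mul_pos hr0 hr0).le
    (by nlinarith)).const_mul C

/-- The summand of the contiguous relation for the normalized series. -/
def nrContig (q : ℝ) (a b c d u v : ℂ) (n : ℕ) : ℂ :=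
  v * ((1 - a * u) * (1 - b * u) * (1 - c * u)) * nrNormTerm q a b c d (u * q) v n -
    u * ((1 - a * v) * (1 - b * v) * (1 - c * v)) * nrNormTerm q a b c d u (v * q) n -
    (v - u) * (1 - u * v) * nrNormTerm q a b c d u v n

/-- Since `uq - d q^{k+1} = q (u - d q^k)`, shifting `u` only shifts the index, so all terms of the
relation share their products. -/
lemma prod_mul_q_sub (u d : ℂ) (m : ℕ) :
    ∏ k ∈ Finset.range (m + 1), (u * q - d * (q : ℂ) ^ k) =
      (u * q - d) * (q : ℂ) ^ m * ∏ k ∈ Finset.range m, (u - d * (q : ℂ) ^ k) := by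
  rw [Finset.prod_range_succ']
  have : ∀ k : ℕ, u * q - d * (q : ℂ) ^ (k + 1) = q * (u - d * (q : ℂ) ^ k) := fun k => by ring
  simp only [this, Finset.prod_mul_distrib, Finset.prod_const, Finset.card_range, pow_zero, mul_one]
  ring

lemma nrContig_zero (hq0 : 0 < q) (hq1 : q < 1) (a b c d u v : ℂ) :
    nrContig q a b c d u v 0 = nrCert q a b c d u v 0 := by
  have hu := qPochInf_eq_mul hq0 hq1 (a * b * c * u)
  have hv := qPochInf_eq_mul hq0 hq1 (a * b * c * v)
  simp only [nrContig, nrCert, nrNormTerm, vwpFactor, qPoch_zero_right, qPoch_succ,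
    Finset.prod_range_zero, pow_zero, pow_one, zero_add, mul_one, one_mul, div_one, ← mul_assoc]
  rw [hu, hv]
  ring

lemma nrContig_succ (hq0 : 0 < q) (hq1 : q < 1) (a b c d u v : ℂ) (m : ℕ) :
    nrContig q a b c d u v (m + 1) = nrCert q a b c d u v (m + 1) - nrCert q a b c d u v m := by
  have hQ : 1 - (q : ℂ) * (q : ℂ) ^ m ≠ 0 := sub_ne_zero.2
    (mul_pow_ne_one hq0 hq1 (norm_ofReal_lt_one hq0 hq1) m).symm
  have hd : ∀ x : ℂ, qPochInf q (x * d * (q : ℂ) ^ m) =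
      (1 - x * d * (q : ℂ) ^ m) * qPochInf q (x * d * (q : ℂ) ^ (m + 1)) := fun x => by
    rw [qPochInf_eq_mul hq0 hq1, pow_succ, ← mul_assoc]
  have hw : ∀ x : ℂ, qPochInf q (a * b * c * x * (q : ℂ) ^ (m + 1)) =
      (1 - a * b * c * x * (q : ℂ) ^ (m + 1)) *
        qPochInf q (a * b * c * x * (q : ℂ) ^ (m + 1 + 1)) := fun x => by
    rw [qPochInf_eq_mul hq0 hq1, pow_succ _ (m + 1), ← mul_assoc]
  have hw' : ∀ x : ℂ, a * b * c * (x * q) * (q : ℂ) ^ (m + 1) =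
      a * b * c * x * (q : ℂ) ^ (m + 1 + 1) := fun x => by ring
  simp only [nrContig, nrCert, nrNormTerm, vwpFactor]
  rw [hw', hw', hw u, hw v, hd, hd, hd, prod_mul_q_sub, prod_mul_q_sub, Finset.prod_range_succ,
    Finset.prod_range_succ, qPoch_succ (a * b) (m + 1), qPoch_succ (a * c) (m + 1),
    qPoch_succ (b * c) (m + 1), qPoch_succ (q : ℂ) m, qPoch_succ (a * b * c * d) m,
    pow_succ (q : ℂ) (2 * m), pow_mul' (q : ℂ) 2 m, pow_succ (q : ℂ) m]
  generalize (q : ℂ) ^ m = X at *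
  generalize qPochInf q _ = Y1
  generalize qPochInf q _ = Y2
  generalize qPochInf q _ = Y3
  generalize qPochInf q _ = Y4
  generalize qPochInf q _ = Y5
  generalize qPoch q (a * b * c * d) m = E
  generalize qPoch q (a * b) _ = A1
  generalize qPoch q (a * c) _ = A2
  generalize qPoch q (b * c) _ = A3
  generalize (∏ k ∈ Finset.range m, (u - d * (q : ℂ) ^ k)) = P1
  generalize (∏ k ∈ Finset.range m, (v - d * (q : ℂ) ^ k)) = P2
  generalize qPoch q (q : ℂ) m = Z
  have hlast : ∀ x : ℂ, x / Z = x * (1 - q * X) / (Z * (1 - q * X)) := fun x =>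
    (mul_div_mul_right x Z hQ).symm
  rw [hlast]
  simp only [div_eq_mul_inv]
  generalize (Z * (1 - q * X))⁻¹ = J
  -- With the common products removed, telescoping is a polynomial identity in `X = q^m` and the
  -- parameters.
  have key : (1 - a * b * c * d * (X ^ 2 * q)) *
      (v * ((1 - a * u) * (1 - b * u) * (1 - c * u)) * ((u * q - d) * X * (v - d * X)) *
        (1 - a * b * c * v * (X * q)) -
      u * ((1 - a * v) * (1 - b * v) * (1 - c * v)) * ((u - d * X) * (v * q - d) * X) *
        (1 - a * b * c * u * (X * q)) -
      (v - u) * (1 - u * v) * ((u - d * X) * (v - d * X) * (1 - a * b * c * u * (X * q)) *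
        (1 - a * b * c * v * (X * q)))) =
      u * v * (v - u) * ((1 - a * b * c * d * X) * (1 - a * b * (X * q)) * (1 - a * c * (X * q)) *
        (1 - b * c * (X * q)) * ((u - d * X) * (v - d * X)) -
      (1 - c * d * X) * (1 - b * d * X) * (1 - a * d * X) * (1 - a * b * c * u * (X * q)) *
        (1 - a * b * c * v * (X * q)) * (1 - q * X)) := by
    ring
  linear_combination (E * (A1 * A2 * A3) * (P1 * P2) * (Y1 * Y2 * Y3 * Y4 * Y5) * J) * key

lemma tsum_nrNormTerm_contiguous (hq0 : 0 < q) (hq1 : q < 1) (a b c d : ℂ) {u v : ℂ}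
    (hu : ‖u‖ < 1) (hv : ‖v‖ < 1) :
    v * ((1 - a * u) * (1 - b * u) * (1 - c * u)) * ∑' n, nrNormTerm q a b c d (u * q) v n -
      u * ((1 - a * v) * (1 - b * v) * (1 - c * v)) * ∑' n, nrNormTerm q a b c d u (v * q) n =
      (v - u) * (1 - u * v) * ∑' n, nrNormTerm q a b c d u v n := by
  have h1 := (summable_nrNormTerm hq0 hq1 a b c d (norm_mul_ofReal_lt hq0 hq1 hu) hv).hasSum
  have h2 := (summable_nrNormTerm hq0 hq1 a b c d hu (norm_mul_ofReal_lt hq0 hq1 hv)).hasSum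
  have h3 := (summable_nrNormTerm hq0 hq1 a b c d hu hv).hasSum
  have h := ((h1.mul_left (v * ((1 - a * u) * (1 - b * u) * (1 - c * u)))).sub
    (h2.mul_left (u * ((1 - a * v) * (1 - b * v) * (1 - c * v))))).sub
    (h3.mul_left ((v - u) * (1 - u * v)))
  -- The partial sum up to `m` is the certificate at `m`, which tends to `0`.
  have hpart : ∀ m, ∑ n ∈ Finset.range (m + 1), nrContig q a b c d u v n =
      nrCert q a b c d u v m := by
    intro m
    induction m with
    | zero => simpa using nrContig_zero hq0 hq1 a b c d u v
    | succ m ih => rw [Finset.sum_range_succ, ih, nrContig_succ hq0 hq1]; ring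
  have ht := (tendsto_add_atTop_iff_nat 1).2 h.tendsto_sum_nat
  have h0 := tendsto_nhds_unique (ht.congr hpart) (tendsto_nrCert hq0 hq1 a b c d hu hv)
  linear_combination h0

end NormalizedSeries

/-! ### The normalized Nassrallah–Rahman identity -/

section NormalizedIdentity

variable {q : ℝ}

/-- The Nassrallah–Rahman integral multiplied by the infinite products that cancel its poles. -/
def nrNormInt (q : ℝ) (a b c d u v : ℂ) : ℂ :=
  nrInt q a b c d u v * (qPochInf q (a * b * c * d) *
    (qPochInf q q * qPochInf q (a * b) * qPochInf q (a * c) * qPochInf q (b * c)) *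
    (qPochInf q (a * u) * qPochInf q (b * u) * qPochInf q (c * u)) *
    (qPochInf q (a * v) * qPochInf q (b * v) * qPochInf q (c * v)))

lemma nrNormInt_swap (a b c d u v : ℂ) : nrNormInt q a b c d u v = nrNormInt q a b c d v u := by
  unfold nrNormInt
  rw [nrInt_swap_right]
  ring

/-- For `v = d` the factor `k = 0` of `∏ (v - d q^k)` kills every term with `n ≥ 1`; the first one
is matched by the Askey–Wilson evaluation. -/
lemma nrNormInt_eq_of_eq (hq0 : 0 < q) (hq1 : q < 1) {a b c d u : ℂ} (ha : ‖a‖ < 1)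
    (hb : ‖b‖ < 1) (hc : ‖c‖ < 1) (hd : ‖d‖ < 1) (hu : ‖u‖ < 1) :
    nrNormInt q a b c d u d = 2 * (Real.pi : ℂ) * ∑' n, nrNormTerm q a b c d u d n := by
  have h0 : ∑' n, nrNormTerm q a b c d u d n = nrNormTerm q a b c d u d 0 := by
    refine tsum_eq_single 0 fun n hn => ?_
    have : ∏ k ∈ Finset.range n, (d - d * (q : ℂ) ^ k) = 0 :=
      Finset.prod_eq_zero (Finset.mem_range.2 (Nat.pos_of_ne_zero hn)) (by simp)
    simp [nrNormTerm, this]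
  have hAW := askeyWilson_integral hq0 hq1 ha hb hc hu
  rw [h0, nrNormInt, nrInt_eq_of_eq hq0 hq1 a b c u hd]
  simp only [nrNormTerm, vwpFactor, qPoch_zero_right, Finset.prod_range_zero, pow_zero, mul_one,
    one_mul, div_one]
  linear_combination (qPochInf q (a * b * c * d) * (qPochInf q (a * d) * qPochInf q (b * d) *
    qPochInf q (c * d))) * hAW

lemma nrNormInt_contiguous (hq0 : 0 < q) (hq1 : q < 1) {a b c u v : ℂ} (d : ℂ) (ha : ‖a‖ < 1)
    (hb : ‖b‖ < 1) (hc : ‖c‖ < 1) (hu : ‖u‖ < 1) (hv : ‖v‖ < 1) :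
    v * ((1 - a * u) * (1 - b * u) * (1 - c * u)) * nrNormInt q a b c d (u * q) v -
      u * ((1 - a * v) * (1 - b * v) * (1 - c * v)) * nrNormInt q a b c d u (v * q) =
      (v - u) * (1 - u * v) * nrNormInt q a b c d u v := by
  have h := nrInt_contiguous hq0 hq1 d ha hb hc hu hv
  have e : ∀ x y : ℂ, qPochInf q (x * y) = (1 - x * y) * qPochInf q (x * (y * q)) := fun x y => by
    rw [qPochInf_eq_mul hq0 hq1, mul_assoc]
  unfold nrNormInt
  rw [e a u, e b u, e c u, e a v, e b v, e c v]
  generalize qPochInf q (a * (u * q)) = A1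
  generalize qPochInf q (b * (u * q)) = B1
  generalize qPochInf q (c * (u * q)) = C1
  generalize qPochInf q (a * (v * q)) = A2
  generalize qPochInf q (b * (v * q)) = B2
  generalize qPochInf q (c * (v * q)) = C2
  generalize qPochInf q (a * b * c * d) *
    (qPochInf q q * qPochInf q (a * b) * qPochInf q (a * c) * qPochInf q (b * c)) = K
  linear_combination (K * (1 - a * u) * A1 * (1 - b * u) * B1 * (1 - c * u) * C1 *
    (1 - a * v) * A2 * (1 - b * v) * B2 * (1 - c * v) * C2) * h

lemma one_sub_mul_ne_zero {x y : ℂ} (hx : ‖x‖ < 1) (hy : ‖y‖ < 1) : 1 - x * y ≠ 0 := by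
  intro h
  have := norm_mul_lt_one hx hy
  rw [← sub_eq_zero.1 h, norm_one] at this
  exact lt_irrefl _ this

/-- The contiguous relation is solved for its term at `vq`, which requires `u ≠ 0`. It also involves
`uq`, so the induction must run over all `u` at once. -/
lemma nrNormInt_eq_of_eq_mul_pow (hq0 : 0 < q) (hq1 : q < 1) {a b c d : ℂ} (ha : ‖a‖ < 1)
    (hb : ‖b‖ < 1) (hc : ‖c‖ < 1) (hd : ‖d‖ < 1) (m : ℕ) :
    ‖d * (q : ℂ) ^ m‖ < 1 ∧ ∀ u : ℂ, ‖u‖ < 1 → u ≠ 0 → nrNormInt q a b c d u (d * (q : ℂ) ^ m) =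
      2 * (Real.pi : ℂ) * ∑' n, nrNormTerm q a b c d u (d * (q : ℂ) ^ m) n := by
  induction m with
  | zero =>
    simp only [pow_zero, mul_one]
    exact ⟨hd, fun u hu _ => nrNormInt_eq_of_eq hq0 hq1 ha hb hc hd hu⟩
  | succ m ih =>
    obtain ⟨hv, ih⟩ := ih
    rw [pow_succ, ← mul_assoc]
    refine ⟨norm_mul_ofReal_lt hq0 hq1 hv, fun u hu hu0 => ?_⟩
    have hq : (q : ℂ) ≠ 0 := by exact_mod_cast hq0.ne'
    have h1 := nrNormInt_contiguous hq0 hq1 d ha hb hc hu hv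
    have h2 := tsum_nrNormTerm_contiguous hq0 hq1 a b c d hu hv
    rw [ih u hu hu0, ih (u * q) (norm_mul_ofReal_lt hq0 hq1 hu) (mul_ne_zero hu0 hq)] at h1
    generalize d * (q : ℂ) ^ m = v at *
    refine mul_left_cancel₀ (mul_ne_zero hu0 (mul_ne_zero (mul_ne_zero (one_sub_mul_ne_zero ha hv)
      (one_sub_mul_ne_zero hb hv)) (one_sub_mul_ne_zero hc hv))) ?_
    linear_combination 2 * (Real.pi : ℂ) * h2 - h1

lemma differentiableOn_nrNormInt (hq0 : 0 < q) (hq1 : q < 1) {a b c u : ℂ} (d : ℂ)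
    (ha : ‖a‖ < 1) (hb : ‖b‖ < 1) (hc : ‖c‖ < 1) (hu : ‖u‖ < 1) :
    DifferentiableOn ℂ (fun v => nrNormInt q a b c d u v) (Metric.ball 0 1) := by
  have h1 : ∀ x : ℂ, Differentiable ℂ fun v => qPochInf q (x * v) :=
    fun x => (differentiable_qPochInf hq0 hq1).comp (by fun_prop)
  unfold nrNormInt
  refine (differentiableOn_nrInt_right hq0 hq1 d ha hb hc hu).mul (Differentiable.differentiableOn ?_)
  exact (((h1 a).mul (h1 b)).mul (h1 c)).const_mul _

lemma differentiable_nrNormInt (hq0 : 0 < q) (hq1 : q < 1) {a b c u v : ℂ}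
    (ha : ‖a‖ < 1) (hb : ‖b‖ < 1) (hc : ‖c‖ < 1) (hu : ‖u‖ < 1) (hv : ‖v‖ < 1) :
    Differentiable ℂ (fun d => nrNormInt q a b c d u v) := by
  have h1 : Differentiable ℂ fun d => qPochInf q (a * b * c * d) :=
    (differentiable_qPochInf hq0 hq1).comp (by fun_prop)
  have h2 := differentiable_nrInt_numerator hq0 hq1 ha hb hc hu hv
  unfold nrNormInt
  fun_prop

lemma nrNormInt_eq (hq0 : 0 < q) (hq1 : q < 1) {a b c u v : ℂ} (d : ℂ) (ha : ‖a‖ < 1)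
    (hb : ‖b‖ < 1) (hc : ‖c‖ < 1) (hu : ‖u‖ < 1) (hv : ‖v‖ < 1) :
    nrNormInt q a b c d u v = 2 * (Real.pi : ℂ) * ∑' n, nrNormTerm q a b c d u v n := by
  have hball : IsPreconnected (Metric.ball (0 : ℂ) 1) := (convex_ball 0 1).isPreconnected
  have h0 : (0 : ℂ) ∈ Metric.ball (0 : ℂ) 1 := by simp
  have hanal : ∀ u d : ℂ, ‖u‖ < 1 →
      AnalyticOnNhd ℂ (fun v => nrNormInt q a b c d u v) (Metric.ball 0 1) ∧
      AnalyticOnNhd ℂ (fun v => 2 * (Real.pi : ℂ) * ∑' n, nrNormTerm q a b c d u v n)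
        (Metric.ball 0 1) := fun u d hu =>
    ⟨(differentiableOn_nrNormInt hq0 hq1 d ha hb hc hu).analyticOnNhd Metric.isOpen_ball,
      ((differentiableOn_tsum_nrNormTerm hq0 hq1 a b c d hu).const_mul _).analyticOnNhd
        Metric.isOpen_ball⟩
  -- Identity theorem in `v`: the points `d q^m` accumulate at `0`, and differ from it as `d ≠ 0`.
  have eq_of_ne_zero : ∀ d u v : ℂ, ‖d‖ < 1 → d ≠ 0 → ‖u‖ < 1 → u ≠ 0 → ‖v‖ < 1 →
      nrNormInt q a b c d u v = 2 * (Real.pi : ℂ) * ∑' n, nrNormTerm q a b c d u v n := by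
    intro d u v hd hd0 hu hu0 hv
    have hq : (q : ℂ) ≠ 0 := by exact_mod_cast hq0.ne'
    have ht : Tendsto (fun m : ℕ => d * (q : ℂ) ^ m) atTop (𝓝[≠] 0) :=
      tendsto_nhdsWithin_iff.2 ⟨tendsto_ofReal_pow_zero hq0 hq1 d,
        Eventually.of_forall fun m => mul_ne_zero hd0 (pow_ne_zero m hq)⟩
    refine (hanal u d hu).1.eqOn_of_preconnected_of_frequently_eq (hanal u d hu).2 hball h0
      (ht.frequently (Frequently.of_forall fun m => ?_)) (by simpa using hv)
    exact (nrNormInt_eq_of_eq_mul_pow hq0 hq1 ha hb hc hd m).2 u hu hu0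
  -- Both sides are entire in `d` and agree on the punctured unit disc, so `d = 0` and `‖d‖ ≥ 1` are
  -- covered.
  have eq_of_left_ne_zero : ∀ d u v : ℂ, ‖u‖ < 1 → u ≠ 0 → ‖v‖ < 1 →
      nrNormInt q a b c d u v = 2 * (Real.pi : ℂ) * ∑' n, nrNormTerm q a b c d u v n := by
    intro d u v hu hu0 hv
    have h1 := (differentiable_nrNormInt hq0 hq1 ha hb hc hu hv).differentiableOn.analyticOnNhd
      isOpen_univ
    have h2 := ((differentiable_tsum_nrNormTerm hq0 hq1 a b c hu hv).const_mul
      (2 * (Real.pi : ℂ))).differentiableOn.analyticOnNhd isOpen_univ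
    refine h1.eqOn_of_preconnected_of_frequently_eq h2 isPreconnected_univ (Set.mem_univ 0)
      (Eventually.frequently ?_) (Set.mem_univ d)
    filter_upwards [self_mem_nhdsWithin, mem_nhdsWithin_of_mem_nhds
      (Metric.ball_mem_nhds (0 : ℂ) one_pos)] with d hd0 hd
    exact eq_of_ne_zero d u v (by simpa using hd) hd0 hu hu0 hv
  -- The value `u = 0` is reached by holomorphy in `u`, which the symmetry in `u`, `v` reduces to
  -- holomorphy in the last argument.
  rw [nrNormInt_swap, tsum_congr fun n => nrNormTerm_swap a b c d u v n]
  refine (hanal v d hv).1.eqOn_of_preconnected_of_frequently_eq (hanal v d hv).2 hball h0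
    (Eventually.frequently ?_) (by simpa using hu)
  filter_upwards [self_mem_nhdsWithin, mem_nhdsWithin_of_mem_nhds
    (Metric.ball_mem_nhds (0 : ℂ) one_pos)] with u hu0 hu
  rw [nrNormInt_swap, tsum_congr fun n => nrNormTerm_swap a b c d v u n]
  exact eq_of_left_ne_zero d u v (by simpa using hu) hu0 hv

end NormalizedIdentity

/-! ### The two forms of the series -/

section Series

variable {q : ℝ}

/-- Each denominator is absorbed through `(x; q)_∞ = (x; q)_n (x q^n; q)_∞`. -/
lemma nrTerm_mul (hq0 : 0 < q) (hq1 : q < 1) {a b c d u v : ℂ}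
    (ha : ‖a‖ < 1) (hb : ‖b‖ < 1) (hc : ‖c‖ < 1) (hu : ‖u‖ < 1) (hv : ‖v‖ < 1)
    (had : ∀ k : ℕ, a * d * (q : ℂ) ^ k ≠ 1) (hbd : ∀ k : ℕ, b * d * (q : ℂ) ^ k ≠ 1)
    (hcd : ∀ k : ℕ, c * d * (q : ℂ) ^ k ≠ 1) (n : ℕ) :
    (qPochInf q (c * d) * qPochInf q (b * d) * qPochInf q (a * d) * qPochInf q (a * b * c * u) *
      qPochInf q (a * b * c * v)) * nrTerm q a b c d u v n = nrNormTerm q a b c d u v n := by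
  have habc := norm_mul_lt_one (norm_mul_lt_one ha hb) hc
  have n1 := qPoch_ne_zero had n
  have n2 := qPoch_ne_zero hbd n
  have n3 := qPoch_ne_zero hcd n
  have n4 := qPoch_ne_zero (mul_pow_ne_one hq0 hq1 (norm_mul_lt_one habc hu)) n
  have n5 := qPoch_ne_zero (mul_pow_ne_one hq0 hq1 (norm_mul_lt_one habc hv)) n
  have n6 := qPoch_ne_zero (mul_pow_ne_one hq0 hq1 (norm_ofReal_lt_one hq0 hq1)) n
  unfold nrTerm nrNormTerm qPochs
  simp only [List.map_cons, List.map_nil, List.prod_cons, List.prod_nil, mul_one,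
    Finset.prod_mul_distrib]
  rw [qPochInf_eq_qPoch_mul hq0 hq1 (c * d) n, qPochInf_eq_qPoch_mul hq0 hq1 (b * d) n,
    qPochInf_eq_qPoch_mul hq0 hq1 (a * d) n, qPochInf_eq_qPoch_mul hq0 hq1 (a * b * c * u) n,
    qPochInf_eq_qPoch_mul hq0 hq1 (a * b * c * v) n, ← mul_div_assoc,
    div_eq_div_iff (by simp only [ne_eq, mul_eq_zero, n1, n2, n3, n4, n5, n6, or_self,
      not_false_eq_true]) n6]
  ring

lemma qPoch_div_mul_pow {d u : ℂ} (hu : u ≠ 0) (n : ℕ) :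
    qPoch q (d / u) n * u ^ n = ∏ k ∈ Finset.range n, (u - d * (q : ℂ) ^ k) := by
  unfold qPoch
  rw [← Finset.card_range n, ← Finset.prod_const, Finset.card_range, ← Finset.prod_mul_distrib]
  refine Finset.prod_congr rfl fun k _ => ?_
  field_simp

/-- The very-well-poised part of a very-well-poised term. -/
lemma qPoch_mul_qPoch_sqrt {s : ℂ} (hs : s ^ 2 ≠ 1) (n : ℕ) :
    qPoch q (s ^ 2) n * (qPoch q (q * s) n * qPoch q (-(q * s)) n) =
      vwpFactor q (q * s ^ 2) n * (qPoch q s n * qPoch q (-s) n) := by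
  have h1 : qPoch q s n * (1 - s * (q : ℂ) ^ n) = (1 - s) * qPoch q (q * s) n := by
    rw [← qPoch_succ, qPoch_succ', mul_comm s]
  have h2 : qPoch q (-s) n * (1 + s * (q : ℂ) ^ n) = (1 + s) * qPoch q (-(q * s)) n := by
    have h := (qPoch_succ (q := q) (-s) n).symm.trans (qPoch_succ' (-s) n)
    rwa [neg_mul, sub_neg_eq_add, sub_neg_eq_add, neg_mul, mul_comm s (q : ℂ)] at h
  have h3 : qPoch q (s ^ 2) n * (1 - s ^ 2 * (q : ℂ) ^ (2 * n)) =
      (1 - s ^ 2) * vwpFactor q (q * s ^ 2) n := by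
    cases n with
    | zero => simp [qPoch_zero_right, vwpFactor]
    | succ n =>
      rw [qPoch_succ', vwpFactor, mul_comm (s ^ 2) (q : ℂ)]
      ring
  refine mul_left_cancel₀ (sub_ne_zero.2 hs.symm) ?_
  rw [pow_mul'] at h3
  linear_combination (qPoch q s n * qPoch q (-s) n) * h3 -
    qPoch q (s ^ 2) n * ((1 + s) * qPoch q (-(q * s)) n * h1 +
      qPoch q s n * (1 - s * (q : ℂ) ^ n) * h2)

lemma vwpTerm_eq_nrTerm (hq0 : 0 < q) {a b c d u v : ℂ}
    (habcd : ∀ k : ℕ, a * b * c * d * (q : ℂ) ^ k ≠ 1) (ha : a ≠ 0) (hb : b ≠ 0) (hc : c ≠ 0)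
    (hd : d ≠ 0) (hu : u ≠ 0) (hv : v ≠ 0) (he : a * b * c * d ≠ q) (n : ℕ) :
    vwpTerm q (a * b * c * d / q) [a * b, a * c, b * c, d / u, d / v] (u * v) n =
      nrTerm q a b c d u v n := by
  have hq : (q : ℂ) ≠ 0 := by exact_mod_cast hq0.ne'
  have hs : ((a * b * c * d / q) ^ (1 / 2 : ℂ)) ^ 2 = a * b * c * d / q := by
    rw [one_div]
    exact Complex.cpow_ofNat_inv_pow _ 2
  have hqα : (q : ℂ) * (a * b * c * d / q) = a * b * c * d := by field_simp
  unfold vwpTerm basicHypTerm vwpNum vwpDen nrTerm qPochs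
  simp only [List.map_cons, List.map_nil, List.prod_cons, List.prod_nil, mul_one, hqα]
  generalize (a * b * c * d / q) ^ (1 / 2 : ℂ) = s at *
  have hs1 : s ^ 2 ≠ 1 := by
    rw [hs, ne_eq, div_eq_one_iff_eq hq]
    exact he
  -- Keeps `(√α, -√α; q)_n` nonzero: `α q^{2k}` is `abcd / q` for `k = 0`, and `abcd` times an odd
  -- power of `q` otherwise.
  have hs2 : ∀ k : ℕ, s ^ 2 * ((q : ℂ) ^ k) ^ 2 ≠ 1 := by
    intro k h
    cases k with
    | zero => exact hs1 (by simpa using h)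
    | succ k =>
      refine habcd (2 * k + 1) ?_
      rw [← h, hs]
      field_simp
      ring
  have m1 := qPoch_ne_zero (q := q) (a := s)
    (fun k h => hs2 k (by linear_combination (s * (q : ℂ) ^ k + 1) * h)) n
  have m2 := qPoch_ne_zero (q := q) (a := -s)
    (fun k h => hs2 k (by linear_combination (-(s * (q : ℂ) ^ k) + 1) * h)) n
  have key := qPoch_mul_qPoch_sqrt (q := q) hs1 n
  rw [hs, hqα] at key
  have r1 : a * b * c * d / (a * b) = c * d := by field_simp
  have r2 : a * b * c * d / (a * c) = b * d := by field_simp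
  have r3 : a * b * c * d / (b * c) = a * d := by field_simp
  have r4 : a * b * c * d / (d / u) = a * b * c * u := by field_simp
  have r5 : a * b * c * d / (d / v) = a * b * c * v := by field_simp
  rw [r1, r2, r3, r4, r5, Finset.prod_mul_distrib, ← qPoch_div_mul_pow hu, ← qPoch_div_mul_pow hv,
    mul_pow, ← mul_div_mul_left (vwpFactor q (a * b * c * d) n * _ * _) _ (mul_ne_zero m1 m2)]
  congr 1
  · linear_combination (qPoch q (a * b) n * qPoch q (a * c) n * qPoch q (b * c) n *
      qPoch q (d / u) n * qPoch q (d / v) n * (u ^ n * v ^ n)) * key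
  · ring

end Series

end

/-! ### The theorem: dividing out the normalizing products -/

theorem theorem2p1 (q : ℝ) (hq0 : 0 < q) (hq1 : q < 1) (a b c d u v : ℂ)
    (ha : ‖a‖ < 1) (hb : ‖b‖ < 1) (hc : ‖c‖ < 1) (hu : ‖u‖ < 1) (hv : ‖v‖ < 1)
    -- no denominator on the right-hand side vanishes
    (habcd : ∀ k : ℕ, a * b * c * d * (q : ℂ) ^ k ≠ 1)
    (had : ∀ k : ℕ, a * d * (q : ℂ) ^ k ≠ 1)
    (hbd : ∀ k : ℕ, b * d * (q : ℂ) ^ k ≠ 1)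
    (hcd : ∀ k : ℕ, c * d * (q : ℂ) ^ k ≠ 1) :
    IntervalIntegrable (nrIntegrand q a b c d u v) MeasureTheory.volume 0 Real.pi ∧
    -- the formula with the series `₈W₇` itself, where its parameters are meaningful
    (a ≠ 0 → b ≠ 0 → c ≠ 0 → d ≠ 0 → u ≠ 0 → v ≠ 0 → a * b * c * d ≠ (q : ℂ) →
      Summable (vwpTerm q (a * b * c * d / q) [a * b, a * c, b * c, d / u, d / v] (u * v)) ∧
      ∫ θ in (0 : ℝ)..Real.pi, nrIntegrand q a b c d u v θ =
        nrPrefactor q a b c d u v *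
          vwpSeries q (a * b * c * d / q) [a * b, a * c, b * c, d / u, d / v] (u * v)) ∧
    -- the formula in general, the series being read with its parameter quotients simplified
    (Summable (nrTerm q a b c d u v) ∧
      ∫ θ in (0 : ℝ)..Real.pi, nrIntegrand q a b c d u v θ =
        nrPrefactor q a b c d u v * ∑' n : ℕ, nrTerm q a b c d u v n) := by
  have habc := norm_mul_lt_one (norm_mul_lt_one ha hb) hc
  have hnorm : ∀ {x y : ℂ}, ‖x‖ < 1 → ‖y‖ < 1 → qPochInf q (x * y) ≠ 0 := fun hx hy =>
    qPochInf_ne_zero_of_norm_lt hq0 hq1 (norm_mul_lt_one hx hy)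
  have hP0 : qPochInf q (c * d) * qPochInf q (b * d) * qPochInf q (a * d) *
      qPochInf q (a * b * c * u) * qPochInf q (a * b * c * v) ≠ 0 :=
    mul_ne_zero (mul_ne_zero (mul_ne_zero (mul_ne_zero (qPochInf_ne_zero hq0 hq1 hcd)
      (qPochInf_ne_zero hq0 hq1 hbd)) (qPochInf_ne_zero hq0 hq1 had)) (hnorm habc hu))
      (hnorm habc hv)
  have hterm := nrTerm_mul hq0 hq1 ha hb hc hu hv had hbd hcd
  have hsum : Summable (nrTerm q a b c d u v) := by
    have h := summable_nrNormTerm hq0 hq1 a b c d hu hv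
    exact (summable_mul_left_iff hP0).1 (h.congr fun n => (hterm n).symm)
  have hint : ∫ θ in (0 : ℝ)..Real.pi, nrIntegrand q a b c d u v θ =
      nrPrefactor q a b c d u v * ∑' n : ℕ, nrTerm q a b c d u v n := by
    have h := nrNormInt_eq hq0 hq1 d ha hb hc hu hv
    rw [← tsum_congr hterm, tsum_mul_left, nrNormInt, nrInt] at h
    unfold nrPrefactor qPochsInf
    simp only [List.map_cons, List.map_nil, List.prod_cons, List.prod_nil, mul_one]
    rw [div_mul_eq_mul_div, eq_div_iff]
    · linear_combination h
    · simp only [ne_eq, mul_eq_zero, qPochInf_ne_zero hq0 hq1 habcd, hnorm ha hb, hnorm ha hc,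
        hnorm hb hc, hnorm ha hu, hnorm hb hu, hnorm hc hu, hnorm ha hv, hnorm hb hv, hnorm hc hv,
        qPochInf_ne_zero_of_norm_lt hq0 hq1 (norm_ofReal_lt_one hq0 hq1), or_self,
        not_false_eq_true]
  refine ⟨(continuous_nrIntegrand hq0 hq1 d ha hb hc hu hv).intervalIntegrable _ _,
    fun ha0 hb0 hc0 hd0 hu0 hv0 he => ?_, hsum, hint⟩
  have hW := vwpTerm_eq_nrTerm hq0 habcd ha0 hb0 hc0 hd0 hu0 hv0 he
  refine ⟨hsum.congr fun n => (hW n).symm, ?_⟩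
  rw [hint, vwpSeries, tsum_congr hW]
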